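/- Let $p$ be a prime, $q=p^e$, $m\ge 1$, $n\ge 0$, $k\ge 1$. Let $\nu_p$ be the $p$-adic valuation on $\mathbb{C}_p$ (the completion of an algebraic closure of $\mathbb{Q}_p$), normalised by $\nu_p(p)=1$, with $\nu_p(0)=\infty$. Let $\xi\in\mathbb{C}_p$ be a primitive $(q^m-1)$-st root of unity, and identify the residue field $\mathbb{Z}_p[\xi]/(p)$ with $\mathbb{F}_{q^m}$ by any ring isomorphism. Let $T:\mathbb{F}_{q^m}\to\mathbb{Z}_p[\xi]$ be the Teichmüller lift: $T(a)$ is the unique root of $X^{q^m}-X$ in $\mathbb{Z}_p[\xi]$ whose residue class modulo $p$ is $a$. For a natural number $a$ let $S_p(a)$ be the sum of its base-$p$ digits, and for $\boldsymbol r=(r_1,\dots,r_k)$ put $|\boldsymbol r|=\sum_i r_i$. For a linear code $D\subseteq\mathbb{F}_q^n$, the $p$-adic valuation of $D$ is the greatest integer $t\ge 0$ such that $p^t$ divides the Hamming weight of every codeword of $D$ (it is $\infty$ if $D=0$). Theorem. Let $C\subseteq\mathbb{F}_{q^m}^n$ be a linear code with a generator matrix $G=(g_{ij})\in\mathbb{F}_{q^m}^{k\times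 n}$ (that is, the rows of $G$ span $C$), and let $$\mathrm{Tr}_{q^m/q}(C)=\{(\mathrm{Tr}_{q^m/q}(c_1),\dots,\mathrm{Tr}_{q^m/q}(c_n)) : (c_1,\dots,c_n)\in C\}\subseteq\mathbb{F}_q^n$$ be its trace code. Then the $p$-adic valuation of $\mathrm{Tr}_{q^m/q}(C)$ is equal to the minimum of $$\frac{1}{p-1}\sum_{i=1}^k S_p(r_i)+\nu_p\Bigl(\sum_{j=1}^n\prod_{i=1}^k T(g_{ij})^{r_i}\Bigr)-e$$ over all $\boldsymbol r\in\{0,1,\dots,q^m-1\}^k$ with $|\boldsymbol r|\equiv 0\pmod{q-1}$ and $|\boldsymbol r|>0$, where $0^0=1$. -/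

import Mathlib

open scoped Padic

noncomputable section

namespace TraceCode

/-! ### The `p`-adic side -/

section Padic

variable (p : ℕ) [Fact p.Prime]

/-- The `p`-adic valuation on `ℂ_p`, normalised by `ν_p(p) = 1` and with `ν_p(0) = ∞`:
`‖x‖ = p ^ (-ν_p(x))` for `x ≠ 0`. -/
def nu (x : ℂ_[p]) : EReal :=
  open Classical in if x = 0 then ⊤ else ((-Real.logb p ‖x‖ : ℝ) : EReal)

/-- The canonical map `ℤ_p → ℂ_p`. -/
def ofPadicInt : ℤ_[p] →+* ℂ_[p] :=
  (algebraMap ℚ_[p] ℂ_[p]).comp PadicInt.Coe.ringHom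

/-- The subring `ℤ_p[ξ]` of `ℂ_p`, i.e. all polynomial expressions in `ξ` over `ℤ_p`. -/
def adjoinInt (ξ : ℂ_[p]) : Subring ℂ_[p] :=
  (Polynomial.eval₂RingHom (ofPadicInt p) ξ).range

/-- The residue ring `ℤ_p[ξ] / (p)`. -/
abbrev ResidueRing (ξ : ℂ_[p]) : Type :=
  adjoinInt p ξ ⧸ Ideal.span {(p : adjoinInt p ξ)}

variable {p}

/-- The reduction map `ℤ_p[ξ] → ℤ_p[ξ] / (p) ≅ F`, for an identification `ι` of the residue ring
with the field `F`. -/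
def reduction {F : Type*} [Field F] {ξ : ℂ_[p]} (ι : ResidueRing p ξ ≃+* F) :
    adjoinInt p ξ →+* F :=
  (ι : ResidueRing p ξ →+* F).comp (Ideal.Quotient.mk _)

/-- The set `U` of all roots of `X ^ Q - X` in `ℤ_p[ξ]`. -/
def rootSet (ξ : ℂ_[p]) (Q : ℕ) : Set (adjoinInt p ξ) :=
  {u | u ^ Q = u}

/-- The Teichmüller lift `T : F → ℂ_p`: the inverse of the bijection `U → F` induced by reduction
modulo `p`, where `U` is the set of roots of `X ^ |F| - X` in `ℤ_p[ξ]`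
(see `reduction_bijOn` for the bijectivity). -/
def teichmullerLift {F : Type*} [Field F] {ξ : ℂ_[p]} (ι : ResidueRing p ξ ≃+* F) (a : F) :
    ℂ_[p] :=
  (Function.invFunOn (reduction ι) (rootSet ξ (Nat.card F)) a : adjoinInt p ξ)

end Padic

/-! ### The coding side -/

section Codes

/-- The trace code `Tr_{F/K}(C)`: the image of `C` under the coordinatewise trace. -/
def traceCode (K : Type*) {F : Type*} [Field K] [Field F] [Algebra K F] {n : ℕ}
    (C : Submodule F (Fin n → F)) : Submodule K (Fin n → K) :=
  (C.restrictScalars K).map ((Algebra.trace K F).compLeft (Fin n))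

/-- `G` is a generator matrix of `C`: its rows span `C`. -/
def IsGeneratorMatrix {F : Type*} [Field F] {k n : ℕ} (G : Matrix (Fin k) (Fin n) F)
    (C : Submodule F (Fin n → F)) : Prop :=
  Submodule.span F (Set.range G.row) = C

/-- A code is `Δ`-divisible if all its Hamming weights are multiples of `Δ`. -/
def IsDivisibleCode {K : Type*} [Field K] {n : ℕ} (C : Submodule K (Fin n → K)) (Δ : ℕ) : Prop :=
  open Classical in ∀ c ∈ C, Δ ∣ hammingNorm c

/-- The `p`-adic valuation of a code: the greatest `t` such that the code is `p ^ t`-divisible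
(`∞` if there is no greatest one, i.e. for the zero code). -/
def codeValuation (p : ℕ) {K : Type*} [Field K] {n : ℕ} (C : Submodule K (Fin n → K)) : EReal :=
  ⨆ (t : ℕ) (_ : IsDivisibleCode C (p ^ t)), ((t : ℝ) : EReal)

end Codes

/-- The sum of the base-`p` digits of `a`. -/
def digitSum (p a : ℕ) : ℕ := (Nat.digits p a).sum

/-! ### The residue ring is the field with `q ^ m` elements, and `T` is well defined -/

section WellDefined

variable {p : ℕ} [Fact p.Prime] {ξ : ℂ_[p]} {N : ℕ}

theorem norm_ofPadicInt (z : ℤ_[p]) : ‖ofPadicInt p z‖ = ‖z‖ := by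
  simp only [ofPadicInt, RingHom.comp_apply, norm_algebraMap']
  rfl

theorem norm_p_lt_one : ‖(p : ℂ_[p])‖ < 1 := by
  have h := norm_ofPadicInt (p := p) (p : ℤ_[p])
  rw [map_natCast] at h
  rw [h]
  rw [PadicInt.norm_p]
  exact inv_lt_one_of_one_lt₀ (by exact_mod_cast (Fact.out : p.Prime).one_lt)

theorem norm_natCast_le (a : ℕ) : ‖(a : ℂ_[p])‖ ≤ 1 := by
  have h := norm_ofPadicInt (p := p) (a : ℤ_[p])
  rw [map_natCast] at h
  rw [h]
  exact PadicInt.norm_le_one _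

theorem one_le_pow_sub (hN : N ≠ 0) : p ^ N - 1 ≠ 0 := by
  have := Nat.one_lt_pow hN (Fact.out : p.Prime).one_lt
  omega

theorem norm_le_one_of_mem (hN : N ≠ 0) (hξ : IsPrimitiveRoot ξ (p ^ N - 1))
    {x : ℂ_[p]} (hx : x ∈ adjoinInt p ξ) : ‖x‖ ≤ 1 := by
  obtain ⟨f, rfl⟩ := hx
  have h1 : ‖ξ‖ = 1 := by
    have h : ‖ξ‖ ^ (p ^ N - 1) = 1 := by rw [← norm_pow, hξ.pow_eq_one, norm_one]
    exact (pow_eq_one_iff_of_nonneg (norm_nonneg _) (one_le_pow_sub hN)).1 h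
  induction f using Polynomial.induction_on' with
  | add f g hf hg =>
    rw [map_add]
    exact (IsUltrametricDist.norm_add_le_max _ _).trans (max_le hf hg)
  | monomial a z =>
    simp only [Polynomial.coe_eval₂RingHom, Polynomial.eval₂_monomial, norm_mul, norm_pow, h1,
      one_pow, mul_one, norm_ofPadicInt]
    exact PadicInt.norm_le_one z

theorem natCast_residueRing : (p : ResidueRing p ξ) = 0 := by
  rw [← map_natCast (Ideal.Quotient.mk (Ideal.span {(p : adjoinInt p ξ)}))]
  exact Ideal.Quotient.eq_zero_iff_mem.2 (Ideal.mem_span_singleton_self _)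

theorem norm_lt_one_of_mk_eq_zero (hN : N ≠ 0) (hξ : IsPrimitiveRoot ξ (p ^ N - 1))
    {x : adjoinInt p ξ} (hx : (Ideal.Quotient.mk _ x : ResidueRing p ξ) = 0) :
    ‖(x : ℂ_[p])‖ < 1 := by
  obtain ⟨y, rfl⟩ := Ideal.mem_span_singleton.1 (Ideal.Quotient.eq_zero_iff_mem.1 hx)
  have hy := norm_le_one_of_mem hN hξ y.2
  have hp := norm_p_lt_one (p := p)
  simp only [Subring.coe_mul, Subring.coe_natCast, norm_mul]
  nlinarith [norm_nonneg (p : ℂ_[p]), norm_nonneg (y : ℂ_[p])]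

theorem residueRing_nontrivial (hN : N ≠ 0) (hξ : IsPrimitiveRoot ξ (p ^ N - 1)) :
    Nontrivial (ResidueRing p ξ) := by
  refine ⟨⟨1, 0, fun h => ?_⟩⟩
  have := norm_lt_one_of_mk_eq_zero hN hξ (x := 1) (by rw [map_one]; exact h)
  simp at this

theorem residueRing_charP (hN : N ≠ 0) (hξ : IsPrimitiveRoot ξ (p ^ N - 1)) :
    CharP (ResidueRing p ξ) p := by
  have := residueRing_nontrivial hN hξ
  have h : ringChar (ResidueRing p ξ) ∣ p := ringChar.dvd natCast_residueRing
  rcases (Nat.dvd_prime Fact.out).1 h with h | h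
  · exact absurd h CharP.ringChar_ne_one
  · exact ringChar.of_eq h

theorem residueRing_pow_card (hN : N ≠ 0) (hξ : IsPrimitiveRoot ξ (p ^ N - 1))
    (b : ResidueRing p ξ) : b ^ p ^ N = b := by
  have := residueRing_charP hN hξ
  have : ExpChar (ResidueRing p ξ) p := ExpChar.prime Fact.out
  obtain ⟨⟨_, f, rfl⟩, rfl⟩ := Ideal.Quotient.mk_surjective b
  let ρ : Polynomial ℤ_[p] →+* adjoinInt p ξ :=
    (Polynomial.eval₂RingHom (ofPadicInt p) ξ).rangeRestrict
  let g : Polynomial ℤ_[p] →+* ResidueRing p ξ := (Ideal.Quotient.mk _).comp ρ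
  have key : ∀ f : Polynomial ℤ_[p], iterateFrobenius _ p N (g f) = g f := by
    intro f
    induction f using Polynomial.induction_on' with
    | add f h hf hh => rw [map_add, map_add, hf, hh]
    | monomial a z =>
      rw [← Polynomial.C_mul_X_pow_eq_monomial, map_mul, map_mul, map_pow, map_pow]
      congr 1
      · obtain ⟨w, hw⟩ := Ideal.mem_span_singleton.1 (PadicInt.appr_spec 1 z)
        have hz : z = (p : ℤ_[p]) * w + (z.appr 1 : ℕ) := by
          rw [pow_one] at hw
          rw [← hw]; ring
        have h0 : g (Polynomial.C z) = ((z.appr 1 : ℕ) : ResidueRing p ξ) := by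
          conv_lhs => rw [hz]
          simp only [map_add, map_mul, map_natCast, natCast_residueRing, zero_mul, zero_add]
        rw [h0, map_natCast]
      · congr 1
        have hX : g Polynomial.X ^ (p ^ N - 1) = 1 := by
          rw [← map_pow]
          have : ρ (Polynomial.X ^ (p ^ N - 1)) = 1 := by
            apply Subtype.ext
            change Polynomial.eval₂ (ofPadicInt p) ξ (Polynomial.X ^ (p ^ N - 1)) = 1
            simp [hξ.pow_eq_one]
          change Ideal.Quotient.mk _ (ρ (Polynomial.X ^ (p ^ N - 1))) = 1
          rw [this, map_one]
        have hpos : p ^ N = (p ^ N - 1) + 1 := by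
          have := Nat.pow_pos (n := N) (Fact.out : p.Prime).pos
          omega
        rw [iterateFrobenius_def, hpos, pow_succ, hX, one_mul]
  exact key f

/-- `ℤ_p[ξ]` is compact, being spanned over `ℤ_p` by finitely many powers of `ξ`. -/
theorem isCompact_adjoinInt (hN : N ≠ 0) (hξ : IsPrimitiveRoot ξ (p ^ N - 1)) :
    IsCompact (adjoinInt p ξ : Set ℂ_[p]) := by
  let φ : (Fin (p ^ N - 1) → ℤ_[p]) → ℂ_[p] := fun c => ∑ i, ofPadicInt p (c i) * ξ ^ (i : ℕ)
  have hc : Continuous (ofPadicInt p) :=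
    (AddMonoidHomClass.isometry_of_norm (ofPadicInt p) norm_ofPadicInt).continuous
  have hφ : Continuous φ := by fun_prop
  have : (adjoinInt p ξ : Set ℂ_[p]) = Set.range φ := by
    apply Set.Subset.antisymm
    · rintro _ ⟨f, rfl⟩
      have hmon : (Polynomial.X ^ (p ^ N - 1) - 1 : Polynomial ℤ_[p]).Monic :=
        Polynomial.monic_X_pow_sub_C 1 (one_le_pow_sub hN)
      have hdeg : (f %ₘ (Polynomial.X ^ (p ^ N - 1) - 1)).natDegree < p ^ N - 1 := by
        have h1 : (Polynomial.X ^ (p ^ N - 1) - 1 : Polynomial ℤ_[p]).natDegree = p ^ N - 1 :=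
          Polynomial.natDegree_X_pow_sub_C (r := 1)
        have h2 := Polynomial.natDegree_modByMonic_lt f hmon (by
          intro h
          rw [h] at h1
          exact one_le_pow_sub (p := p) hN (by simpa using h1.symm))
        rwa [h1] at h2
      refine ⟨fun i => (f %ₘ (Polynomial.X ^ (p ^ N - 1) - 1)).coeff i, ?_⟩
      have h3 := Polynomial.modByMonic_add_div f (Polynomial.X ^ (p ^ N - 1) - 1)
      have h4 : Polynomial.eval₂ (ofPadicInt p) ξ f =
          Polynomial.eval₂ (ofPadicInt p) ξ (f %ₘ (Polynomial.X ^ (p ^ N - 1) - 1)) := by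
        conv_lhs => rw [← h3]
        simp [Polynomial.eval₂_add, Polynomial.eval₂_mul, hξ.pow_eq_one]
      rw [Polynomial.coe_eval₂RingHom, h4, Polynomial.eval₂_eq_sum_range' _ hdeg,
        ← Fin.sum_univ_eq_sum_range
          (fun i => ofPadicInt p ((f %ₘ (Polynomial.X ^ (p ^ N - 1) - 1)).coeff i) * ξ ^ i)]
    · rintro _ ⟨c, rfl⟩
      refine Subring.sum_mem _ fun i _ => Subring.mul_mem _ ?_ (Subring.pow_mem _ ?_ _)
      · exact ⟨Polynomial.C (c i), by simp⟩
      · exact ⟨Polynomial.X, by simp⟩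
  rw [this]
  exact isCompact_range hφ

/-- The elements of `ℤ_p[ξ]` of norm less than one are the multiples of `p`. -/
theorem mk_eq_zero_of_norm_lt_one (hN : N ≠ 0) (hξ : IsPrimitiveRoot ξ (p ^ N - 1))
    {x : adjoinInt p ξ} (hx : ‖(x : ℂ_[p])‖ < 1) :
    (Ideal.Quotient.mk _ x : ResidueRing p ξ) = 0 := by
  have hcl : IsClosed ((fun y : ℂ_[p] => (p : ℂ_[p]) * y) '' (adjoinInt p ξ : Set ℂ_[p])) :=
    ((isCompact_adjoinInt hN hξ).image (by fun_prop)).isClosed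
  have hmem : ∀ j : ℕ, (x : ℂ_[p]) - (x : ℂ_[p]) ^ (p ^ N) ^ j ∈
      (fun y : ℂ_[p] => (p : ℂ_[p]) * y) '' (adjoinInt p ξ : Set ℂ_[p]) := by
    intro j
    have h : ∀ b : ResidueRing p ξ, b ^ (p ^ N) ^ j = b := by
      intro b
      induction j with
      | zero => simp
      | succ j ih => rw [pow_succ, pow_mul, ih, residueRing_pow_card hN hξ]
    have h' : (Ideal.Quotient.mk _ (x - x ^ (p ^ N) ^ j) : ResidueRing p ξ) = 0 := by
      rw [map_sub, map_pow, h, sub_self]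
    obtain ⟨y, hy⟩ := Ideal.mem_span_singleton.1 (Ideal.Quotient.eq_zero_iff_mem.1 h')
    refine ⟨y, y.2, ?_⟩
    have := congrArg (Subtype.val) hy
    simpa using this.symm
  have h1 : 1 < p ^ N := Nat.one_lt_pow hN (Fact.out : p.Prime).one_lt
  have hlim : Filter.Tendsto (fun j : ℕ => (x : ℂ_[p]) - (x : ℂ_[p]) ^ (p ^ N) ^ j) Filter.atTop
      (nhds ((x : ℂ_[p]) - 0)) :=
    tendsto_const_nhds.sub
      ((tendsto_pow_atTop_nhds_zero_of_norm_lt_one hx).comp (tendsto_pow_atTop_atTop_of_one_lt h1))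
  obtain ⟨y, hy, hxy⟩ := hcl.mem_of_tendsto hlim (Filter.Eventually.of_forall hmem)
  rw [sub_zero] at hxy
  refine Ideal.Quotient.eq_zero_iff_mem.2 (Ideal.mem_span_singleton.2 ⟨⟨y, hy⟩, ?_⟩)
  apply Subtype.ext
  simpa using hxy.symm

theorem residueRing_isDomain (hN : N ≠ 0) (hξ : IsPrimitiveRoot ξ (p ^ N - 1)) :
    IsDomain (ResidueRing p ξ) := by
  have := residueRing_nontrivial hN hξ
  have : NoZeroDivisors (ResidueRing p ξ) := by
    refine ⟨fun {a b} hab => ?_⟩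
    obtain ⟨a, rfl⟩ := Ideal.Quotient.mk_surjective a
    obtain ⟨b, rfl⟩ := Ideal.Quotient.mk_surjective b
    rw [← map_mul] at hab
    have h := norm_lt_one_of_mk_eq_zero hN hξ hab
    rw [Subring.coe_mul, norm_mul] at h
    by_contra! hcon
    have ha : 1 ≤ ‖(a : ℂ_[p])‖ :=
      not_lt.1 fun h' => hcon.1 (mk_eq_zero_of_norm_lt_one hN hξ h')
    have hb : 1 ≤ ‖(b : ℂ_[p])‖ :=
      not_lt.1 fun h' => hcon.2 (mk_eq_zero_of_norm_lt_one hN hξ h')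
    nlinarith
  exact NoZeroDivisors.to_isDomain _

/-- Reduction modulo `p` is injective on the roots of `X ^ (p ^ N) - X`. -/
theorem mk_injOn_rootSet (hN : N ≠ 0) (hξ : IsPrimitiveRoot ξ (p ^ N - 1)) :
    Set.InjOn (fun u => (Ideal.Quotient.mk _ u : ResidueRing p ξ)) (rootSet ξ (p ^ N)) := by
  intro u hu v hv huv
  have hu' : u ^ p ^ N = u := hu
  have hv' : v ^ p ^ N = v := hv
  have hd : (Ideal.Quotient.mk _ (u - v) : ResidueRing p ξ) = 0 := by
    rw [map_sub]; exact sub_eq_zero.2 huv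
  obtain ⟨w, hw⟩ := Ideal.mem_span_singleton.1 (Ideal.Quotient.eq_zero_iff_mem.1 hd)
  by_contra hne
  -- `u ^ Q - v ^ Q = (u - v) * s` with `s ≡ Q * v ^ (Q - 1) ≡ 0`, whereas `s = 1`.
  have hs : (∑ i ∈ Finset.range (p ^ N), u ^ i * v ^ (p ^ N - 1 - i)) = 1 := by
    have h := (Commute.all u v).geom_sum₂_mul (p ^ N)
    rw [hu', hv'] at h
    exact mul_right_cancel₀ (sub_ne_zero.2 hne) (h.trans (one_mul _).symm)
  have := residueRing_nontrivial hN hξ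
  have h0 := congrArg (Ideal.Quotient.mk (Ideal.span {(p : adjoinInt p ξ)})) hs
  have huv' : (Ideal.Quotient.mk _ u : ResidueRing p ξ) = Ideal.Quotient.mk _ v := huv
  rw [map_sum, map_one] at h0
  simp only [map_mul, map_pow, huv'] at h0
  rw [Finset.sum_congr rfl (g := fun _ => (Ideal.Quotient.mk _ v : ResidueRing p ξ) ^ (p ^ N - 1))
    (fun i hi => by
      rw [← pow_add]
      congr 1
      have := Finset.mem_range.1 hi
      omega)] at h0
  rw [Finset.sum_const, Finset.card_range, nsmul_eq_mul, Nat.cast_pow, natCast_residueRing,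
    zero_pow hN, zero_mul] at h0
  exact zero_ne_one h0

theorem rootSet_ncard (hN : N ≠ 0) (hξ : IsPrimitiveRoot ξ (p ^ N - 1)) :
    ∃ f : Option (Fin (p ^ N - 1)) → adjoinInt p ξ,
      Function.Injective f ∧ ∀ i, f i ∈ rootSet ξ (p ^ N) := by
  let z : adjoinInt p ξ := ⟨ξ, Polynomial.X, by simp⟩
  have hz : IsPrimitiveRoot z (p ^ N - 1) :=
    IsPrimitiveRoot.of_map_of_injective (f := (adjoinInt p ξ).subtype) hξ Subtype.val_injective
  have hpos : p ^ N = (p ^ N - 1) + 1 := by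
    have := Nat.pow_pos (n := N) (Fact.out : p.Prime).pos
    omega
  have hz0 : z ≠ 0 := hz.ne_zero (one_le_pow_sub hN)
  refine ⟨fun i => i.elim 0 fun j => z ^ (j : ℕ), ?_, ?_⟩
  · rintro (_ | i) (_ | j) h
    · rfl
    · exact absurd h.symm (pow_ne_zero _ hz0)
    · exact absurd h (pow_ne_zero _ hz0)
    · exact congrArg some (Fin.ext (hz.pow_inj i.2 j.2 h))
  · rintro (_ | i)
    · change (0 : adjoinInt p ξ) ^ p ^ N = 0
      exact zero_pow (by omega)
    · change (z ^ (i : ℕ)) ^ p ^ N = z ^ (i : ℕ)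
      rw [← pow_mul, mul_comm, pow_mul]
      congr 1
      rw [hpos, pow_succ, hz.pow_eq_one, one_mul]

theorem finite_card_le_of_pow_eq (R : Type*) [CommRing R] [IsDomain R] {Q : ℕ} (hQ : 1 < Q)
    (h : ∀ b : R, b ^ Q = b) : Finite R ∧ Nat.card R ≤ Q := by
  classical
  have hdeg : (Polynomial.X ^ Q - Polynomial.X : Polynomial R).natDegree = Q := by
    have h1 : (Polynomial.X : Polynomial R).degree < (Polynomial.X ^ Q : Polynomial R).degree := by
      rw [Polynomial.degree_X_pow, Polynomial.degree_X]
      exact_mod_cast hQ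
    rw [Polynomial.natDegree_eq_of_degree_eq (Polynomial.degree_sub_eq_left_of_degree_lt h1),
      Polynomial.natDegree_X_pow]
  have hne : (Polynomial.X ^ Q - Polynomial.X : Polynomial R) ≠ 0 := by
    intro h0
    rw [h0, Polynomial.natDegree_zero] at hdeg
    omega
  have hroot : ∀ b : R, b ∈ (Polynomial.X ^ Q - Polynomial.X : Polynomial R).roots.toFinset := by
    intro b
    rw [Multiset.mem_toFinset, Polynomial.mem_roots hne]
    simp [h b]
  have hfin : Finite R :=
    Set.finite_univ_iff.1 ((Finset.finite_toSet _).subset fun b _ => hroot b)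
  refine ⟨hfin, ?_⟩
  have := Fintype.ofFinite R
  rw [Nat.card_eq_fintype_card, ← Finset.card_univ]
  calc _ ≤ _ := Finset.card_le_card fun b _ => hroot b
    _ ≤ _ := Multiset.toFinset_card_le _
    _ ≤ _ := Polynomial.card_roots' _
    _ = _ := hdeg

theorem residueRing_finite_card (hN : N ≠ 0) (hξ : IsPrimitiveRoot ξ (p ^ N - 1)) :
    Finite (ResidueRing p ξ) ∧ Nat.card (ResidueRing p ξ) = p ^ N := by
  have := residueRing_isDomain hN hξ
  obtain ⟨hfin, hle⟩ := finite_card_le_of_pow_eq (ResidueRing p ξ)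
    (Nat.one_lt_pow hN (Fact.out : p.Prime).one_lt) (residueRing_pow_card hN hξ)
  refine ⟨hfin, le_antisymm hle ?_⟩
  · obtain ⟨f, hf, hmem⟩ := rootSet_ncard hN hξ
    have hinj : Function.Injective fun i => (Ideal.Quotient.mk _ (f i) : ResidueRing p ξ) :=
      fun i j h => hf (mk_injOn_rootSet hN hξ (hmem i) (hmem j) h)
    have hcard : Nat.card (Option (Fin (p ^ N - 1))) ≤ Nat.card (ResidueRing p ξ) :=
      Nat.card_le_card_of_injective _ hinj
    rw [Nat.card_eq_fintype_card, Fintype.card_option, Fintype.card_fin] at hcard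
    exact le_trans (by omega) hcard

/-- The residue ring `ℤ_p[ξ] / (p)`, for `ξ` a primitive root of unity of order `|F| - 1`, can be
identified with the finite field `F`. -/
theorem nonempty_residueRing_equiv (F : Type*) [Field F] [Finite F] (hF : Nat.card F = p ^ N)
    (hξ : IsPrimitiveRoot ξ (p ^ N - 1)) : Nonempty (ResidueRing p ξ ≃+* F) := by
  have hN : N ≠ 0 := by
    rintro rfl
    have := Finite.one_lt_card (α := F)
    simp [hF] at this
  obtain ⟨hfin, hcard⟩ := residueRing_finite_card hN hξ
  have := residueRing_isDomain hN hξ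
  let _ : Field (ResidueRing p ξ) := (Finite.isDomain_to_isField _).toField
  have := Fintype.ofFinite (ResidueRing p ξ)
  have := Fintype.ofFinite F
  exact ⟨FiniteField.ringEquivOfCardEq
    (by rw [← Nat.card_eq_fintype_card, ← Nat.card_eq_fintype_card, hcard, hF])⟩

/-- Reduction modulo `p` is a bijection from the set of roots of `X ^ |F| - X` onto `F`; the
Teichmüller lift is its inverse. -/
theorem reduction_bijOn {F : Type*} [Field F] [Finite F] (hF : Nat.card F = p ^ N)
    (hξ : IsPrimitiveRoot ξ (p ^ N - 1)) (ι : ResidueRing p ξ ≃+* F) :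
    Set.BijOn (reduction ι) (rootSet ξ (Nat.card F)) Set.univ := by
  have hN : N ≠ 0 := by
    rintro rfl
    have := Finite.one_lt_card (α := F)
    simp [hF] at this
  rw [hF]
  have hinj : Set.InjOn (reduction ι) (rootSet ξ (p ^ N)) :=
    fun u hu v hv h => mk_injOn_rootSet hN hξ hu hv (ι.injective h)
  refine ⟨fun _ _ => Set.mem_univ _, hinj, ?_⟩
  obtain ⟨f, hf, hmem⟩ := rootSet_ncard hN hξ
  have hinj' : Function.Injective fun i => reduction ι (f i) :=
    fun i j h => hf (hinj (hmem i) (hmem j) h)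
  have hbij := (Nat.bijective_iff_injective_and_card _).2 ⟨hinj', by
    have : 0 < p ^ N := Nat.pow_pos (Fact.out : p.Prime).pos
    rw [hF, Nat.card_eq_fintype_card, Fintype.card_option, Fintype.card_fin]
    omega⟩
  intro a _
  obtain ⟨i, hi⟩ := hbij.2 a
  exact ⟨f i, hmem i, hi⟩

end WellDefined

end TraceCode

end

/-! Write $Q=q^m$, fix a primitive $p$-th root of unity $\zeta$ and let
$\psi(x)=\zeta^{\mathrm{Tr}\,x}$ on $F$, with trace down to $\mathbb{F}_p$. Like every function on
$F$, $\psi$ is a polynomial $\sum_{r<Q}c_rT(x)^r$; up to a unit, $c_r$ is for $0<r<Q-1$ the Gauss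
sum of $T^{-r}$. Stickelberger's theorem gives $|c_r|=|1-\zeta|^{S_p(r)}$, that is, valuation
$S_p(r)/(p-1)$, and this also holds at both ends $r=0$ and $r=Q-1$ (`norm_charCoeff`).

For $y\in F$ the sum $\sum_{b\in K^\times}\psi(by)$ is $q-1$ minus $q$ if the trace of $y$ to $K$ is
nonzero. Summed over the coordinates of $aG$, this yields the weight $w(a)$ of the trace codeword of
the message $a$. Expanding $\psi$ instead, the sum over $b$ kills every exponent vector with
$q-1\nmid|r|$, and the term $r=0$ cancels the constant $n(q-1)$. Hence (`sum_weightCoeff`)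
$-q\,w(a)=(q-1)\sum_r C_r\prod_i T(a_i)^{r_i}$, where $C_r=\prod_i c_{r_i}\cdot\sum_j\prod_i
T(g_{ij})^{r_i}$ and $r$ runs over the vectors admitted in the theorem.

Since $Q-1$ is a $p$-adic unit, passing between coefficients and values at Teichmüller points is
integral in both directions (`norm_coeff_le`, `norm_eval_le`). So $\max_a|q\,w(a)|=\max_r|C_r|$;
taking valuations gives the theorem. -/

namespace TraceCode

/-! ### Base-$p$ digit sums -/

section DigitSum

variable {p : ℕ}

theorem digitSum_zero : digitSum p 0 = 0 := by simp [digitSum]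

theorem digitSum_mul_add (hp : 1 < p) (a : ℕ) {b : ℕ} (hb : b < p) :
    digitSum p (p * a + b) = b + digitSum p a := by
  by_cases h : b ≠ 0 ∨ a ≠ 0
  · rw [digitSum, add_comm, Nat.digits_add p hp b a hb h, List.sum_cons, digitSum]
  · push Not at h
    simp [h.1, h.2, digitSum]

/-- The digits of `a` and of `p ^ N - 1 - a` add up to `p - 1` in each of the `N` positions. -/
theorem digitSum_add_digitSum (hp : 1 < p) {N a b : ℕ} (h : a + b = p ^ N - 1) :
    digitSum p a + digitSum p b = (p - 1) * N := by
  induction N generalizing a b with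
  | zero =>
    obtain ⟨rfl, rfl⟩ : a = 0 ∧ b = 0 := by simpa using h
    simp [digitSum]
  | succ N ih =>
    have hpos : 0 < p ^ N := Nat.pow_pos (by omega)
    have hmod : a % p < p := Nat.mod_lt _ (by omega)
    have ha : p * (a / p) + a % p = a := Nat.div_add_mod a p
    have hlt : a / p < p ^ N := by
      rw [Nat.div_lt_iff_lt_mul (by omega), ← pow_succ]
      have : 0 < p ^ (N + 1) := Nat.pow_pos (by omega)
      omega
    -- No carries occur: `b` has last digit `p - 1 - a % p`, and its remaining digits form the
    -- complement `c` of `a / p`.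
    obtain ⟨c, hc⟩ : ∃ c, a / p + c = p ^ N - 1 := ⟨p ^ N - 1 - a / p, by omega⟩
    have hb : b = p * c + (p - 1 - a % p) := by
      have h1 : p * (a / p) + p * c + p = p ^ (N + 1) := by
        rw [← mul_add, hc, ← Nat.mul_succ, pow_succ, mul_comm]
        congr 1
        omega
      have : 0 < p ^ (N + 1) := Nat.pow_pos (by omega)
      omega
    have h2 : digitSum p a = a % p + digitSum p (a / p) := by
      conv_lhs => rw [← ha]
      exact digitSum_mul_add hp _ hmod
    rw [h2, hb, digitSum_mul_add hp _ (by omega), Nat.mul_succ, ← ih hc]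
    omega

end DigitSum

/-! ### Norms of $1-\zeta^i$ -/

section Ultrametric

variable {p : ℕ} [Fact p.Prime]

theorem norm_sum_le_one {α : Type*} (s : Finset α) {f : α → ℂ_[p]} (h : ∀ i ∈ s, ‖f i‖ ≤ 1) :
    ‖∑ i ∈ s, f i‖ ≤ 1 :=
  IsUltrametricDist.norm_sum_le_of_forall_le_of_nonneg zero_le_one h

theorem norm_prime : ‖(p : ℂ_[p])‖ = (p : ℝ)⁻¹ := by
  have h := norm_ofPadicInt (p := p) (p : ℤ_[p])
  rwa [map_natCast, PadicInt.norm_p] at h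

/-- A natural number not divisible by `p` is a unit of the valuation ring. -/
theorem norm_natCast_eq_one {a : ℕ} (h : ¬ p ∣ a) : ‖(a : ℂ_[p])‖ = 1 := by
  have h' := norm_ofPadicInt (p := p) (a : ℤ_[p])
  rw [map_natCast] at h'
  rw [h', PadicInt.norm_def, PadicInt.coe_natCast]
  exact Padic.norm_natCast_eq_one_iff.2 ((Nat.Prime.coprime_iff_not_dvd Fact.out).2 h)

theorem norm_root_eq_one {ζ : ℂ_[p]} (hζ : IsPrimitiveRoot ζ p) : ‖ζ‖ = 1 :=
  (pow_eq_one_iff_of_nonneg (norm_nonneg _) (Fact.out : p.Prime).ne_zero).1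
    (by rw [← norm_pow, hζ.pow_eq_one, norm_one])

theorem norm_one_sub_pow_le {ζ : ℂ_[p]} (hζ : ‖ζ‖ ≤ 1) (i : ℕ) : ‖1 - ζ ^ i‖ ≤ ‖1 - ζ‖ := by
  rw [← mul_neg_geom_sum, norm_mul]
  refine mul_le_of_le_one_right (norm_nonneg _) (norm_sum_le_one _ fun j _ => ?_)
  rw [norm_pow]
  exact pow_le_one₀ (norm_nonneg _) hζ

/-- $\zeta$ and $\zeta^i$ are powers of each other, so each of $1-\zeta$, $1-\zeta^i$ is an integral
multiple of the other. -/
theorem norm_one_sub_pow {ζ : ℂ_[p]} (hζ : IsPrimitiveRoot ζ p) {i : ℕ} (hi : ¬ p ∣ i) :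
    ‖1 - ζ ^ i‖ = ‖1 - ζ‖ := by
  have h1 := norm_root_eq_one hζ
  refine le_antisymm (norm_one_sub_pow_le h1.le i) ?_
  have hprim := hζ.pow_of_coprime i ((Nat.Prime.coprime_iff_not_dvd Fact.out).2 hi).symm
  obtain ⟨j, -, hj⟩ := hprim.eq_pow_of_pow_eq_one hζ.pow_eq_one
  conv_lhs => rw [← hj]
  exact norm_one_sub_pow_le (by rw [norm_pow, h1, one_pow]) j

/-- `1 - ζ` has valuation `1 / (p - 1)`. -/
theorem norm_one_sub_pow_pred {ζ : ℂ_[p]} (hζ : IsPrimitiveRoot ζ p) :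
    ‖1 - ζ‖ ^ (p - 1) = ‖(p : ℂ_[p])‖ := by
  obtain ⟨n, hn⟩ : ∃ n, p = n + 1 := ⟨p - 1, by have := (Fact.out : p.Prime).pos; omega⟩
  -- The $p-1$ factors of $\prod_{0<i<p}(1-\zeta^i)=p$ all have the same norm.
  have h := IsPrimitiveRoot.prod_one_sub_pow_eq_order (n := n) (μ := ζ) (by rwa [← hn])
  have h2 : (p : ℂ_[p]) = n + 1 := by exact_mod_cast congrArg (Nat.cast (R := ℂ_[p])) hn
  rw [h2, ← h, norm_prod, Finset.prod_congr rfl (g := fun _ => ‖1 - ζ‖)]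
  · simp [hn]
  · intro i hi
    refine norm_one_sub_pow hζ fun hd => ?_
    have := Nat.le_of_dvd (by omega) hd
    have := Finset.mem_range.1 hi
    omega

theorem norm_one_sub_root_lt_one {ζ : ℂ_[p]} (hζ : IsPrimitiveRoot ζ p) : ‖1 - ζ‖ < 1 := by
  by_contra! h
  have := one_le_pow₀ h (n := p - 1)
  rw [norm_one_sub_pow_pred hζ] at this
  exact absurd norm_p_lt_one this.not_gt

/-- Second order expansion of the powers of `ζ` around `1`. -/
theorem exists_pow_eq_expansion {ζ : ℂ_[p]} (hζ : ‖ζ‖ ≤ 1) (a : ℕ) :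
    ∃ w : ℂ_[p], ‖w‖ ≤ 1 ∧ ζ ^ a = 1 - a * (1 - ζ) + (1 - ζ) ^ 2 * w := by
  induction a with
  | zero => exact ⟨0, by simp⟩
  | succ a ih =>
    obtain ⟨w, hw, h⟩ := ih
    refine ⟨a + ζ * w, (IsUltrametricDist.norm_add_le_max _ _).trans (max_le ?_ ?_), ?_⟩
    · exact norm_natCast_le a
    · rw [norm_mul]
      exact mul_le_one₀ hζ (norm_nonneg _) hw
    · rw [pow_succ, h]
      push_cast
      ring

end Ultrametric

/-! ### Multiplicative lifts as characters -/

section MulChar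

variable {p : ℕ} [Fact p.Prime] {F : Type*} [Field F]

/-- A multiplicative map between fields, as a multiplicative character. -/
noncomputable def mulCharOfHom (T : F →*₀ ℂ_[p]) : MulChar F ℂ_[p] :=
  { (T : F →* ℂ_[p]) with
    map_nonunit' := fun a ha => by
      have : a = 0 := by simpa using ha
      simp [this] }

theorem mulCharOfHom_apply (T : F →*₀ ℂ_[p]) (x : F) : mulCharOfHom T x = T x := rfl

variable [Fintype F]

theorem norm_hom_le_one (T : F →*₀ ℂ_[p]) (x : F) : ‖T x‖ ≤ 1 := by
  by_cases hx : x = 0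
  · simp [hx]
  · refine ((pow_eq_one_iff_of_nonneg (norm_nonneg _) (n := Fintype.card F - 1) ?_).1 ?_).le
    · have := Fintype.one_lt_card (α := F)
      omega
    · rw [← norm_pow, ← map_pow, FiniteField.pow_card_sub_one_eq_one x hx, map_one, norm_one]

theorem norm_mulChar_le_one (χ : MulChar F ℂ_[p]) (x : F) : ‖χ x‖ ≤ 1 :=
  norm_hom_le_one (χ.toMonoidWithZeroHom) x

/-- A multiplicative section of reduction modulo the maximal ideal: integral relations between
the values that hold modulo the maximal ideal hold in the residue field. -/
def IsMultiplicativeLift (T : F →*₀ ℂ_[p]) : Prop :=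
  ∀ z : F → ℤ, ‖∑ x, (z x : ℂ_[p]) * T x‖ < 1 → ∑ x, (z x : F) * x = 0

theorem IsMultiplicativeLift.injective {T : F →*₀ ℂ_[p]} (hT : IsMultiplicativeLift T) :
    Function.Injective T := by
  classical
  intro x y hxy
  have h := hT (fun a => (if a = x then 1 else 0) - (if a = y then 1 else 0)) (by
    simp [sub_mul, Finset.sum_sub_distrib, hxy])
  simpa [sub_mul, Finset.sum_sub_distrib, sub_eq_zero] using h

/-- By injectivity of `T` its order as a character is the exponent of the cyclic group $F^\times$.
-/
theorem IsMultiplicativeLift.inv_pow_eq_one_iff {T : F →*₀ ℂ_[p]} (hT : IsMultiplicativeLift T)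
    (r : ℕ) : (mulCharOfHom T)⁻¹ ^ r = 1 ↔ Fintype.card F - 1 ∣ r := by
  rw [inv_pow, inv_eq_one, ← FiniteField.forall_pow_eq_one_iff, MulChar.ext_iff]
  refine forall_congr' fun x => ?_
  rw [MulChar.pow_apply_coe, MulChar.one_apply_coe, mulCharOfHom_apply, ← map_pow, ← map_one T,
    hT.injective.eq_iff, Units.ext_iff, Units.val_pow_eq_pow_val, Units.val_one]

theorem norm_jacobiSum_le_one (χ φ : MulChar F ℂ_[p]) : ‖jacobiSum χ φ‖ ≤ 1 := by
  refine norm_sum_le_one _ fun x _ => ?_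
  rw [norm_mul]
  exact mul_le_one₀ (norm_mulChar_le_one χ x) (norm_nonneg _) (norm_mulChar_le_one φ _)

end MulChar

/-! ### Gauss sums and Stickelberger's theorem -/

section GaussSum

variable {p : ℕ} [Fact p.Prime] {F : Type*} [Field F] [Algebra (ZMod p) F]

/-- The additive character `x ↦ ζ ^ Tr x` of a finite field of characteristic `p`. -/
noncomputable def traceChar (F : Type*) [Field F] [Algebra (ZMod p) F] {ζ : ℂ_[p]}
    (hζ : IsPrimitiveRoot ζ p) : AddChar F ℂ_[p] :=
  (AddChar.zmodChar p hζ.pow_eq_one).compAddMonoidHom (Algebra.trace (ZMod p) F).toAddMonoidHom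

theorem traceChar_apply {ζ : ℂ_[p]} (hζ : IsPrimitiveRoot ζ p) (x : F) :
    traceChar F hζ x = ζ ^ (Algebra.trace (ZMod p) F x).val := rfl

theorem traceChar_eq_one_iff {ζ : ℂ_[p]} (hζ : IsPrimitiveRoot ζ p) (x : F) :
    traceChar F hζ x = 1 ↔ Algebra.trace (ZMod p) F x = 0 := by
  rw [traceChar_apply, hζ.pow_eq_one_iff_dvd, ← ZMod.natCast_eq_zero_iff, ZMod.natCast_zmod_val]

variable [Fintype F]

theorem traceChar_ne_one {ζ : ℂ_[p]} (hζ : IsPrimitiveRoot ζ p) : traceChar F hζ ≠ 1 := by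
  obtain ⟨x, hx⟩ := Algebra.trace_surjective (ZMod p) F 1
  refine AddChar.ne_one_iff.2 ⟨x, fun h => ?_⟩
  rw [traceChar_eq_one_iff, hx] at h
  exact one_ne_zero h

theorem traceChar_pow {ζ : ℂ_[p]} (hζ : IsPrimitiveRoot ζ p) (x : F) :
    traceChar F hζ (x ^ p) = traceChar F hζ x := by
  have h := Algebra.trace_eq_of_algEquiv (FiniteField.frobeniusAlgEquivOfAlgebraic (ZMod p) F) x
  rw [FiniteField.coe_frobeniusAlgEquivOfAlgebraic, ZMod.card] at h
  rw [traceChar_apply, traceChar_apply, h]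

variable {ζ : ℂ_[p]} (hζ : IsPrimitiveRoot ζ p)

/-- `∑ x, x⁻¹ * Tr x = -1`. -/
theorem sum_inv_mul_trace (hcard : 2 < Fintype.card F) :
    ∑ x : F, x⁻¹ * algebraMap (ZMod p) F (Algebra.trace (ZMod p) F x) = -1 := by
  classical
  have hp := (Fact.out : p.Prime).one_lt
  obtain ⟨N, hN⟩ : ∃ N, Module.finrank (ZMod p) F = N + 1 :=
    ⟨_, (Nat.succ_pred_eq_of_pos Module.finrank_pos).symm⟩
  have hF : Fintype.card F = p ^ (N + 1) := by
    rw [Module.card_eq_pow_finrank (K := ZMod p), ZMod.card, hN]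
  simp_rw [FiniteField.algebraMap_trace_eq_sum_pow, Finset.mul_sum, Nat.card_zmod, hN]
  -- With $\mathrm{Tr}\,x=\sum_i x^{p^i}$, the term $i=0$ counts $F^\times$ and gives $-1$; the
  -- others are power sums of exponent $p^i-1<|F|-1$, which vanish.
  rw [Finset.sum_comm, Finset.sum_range_succ', Finset.sum_eq_zero, zero_add]
  · have h1 : ∀ x : F, x⁻¹ * x ^ p ^ 0 = 1 - if x = 0 then 1 else 0 := by
      intro x
      by_cases hx : x = 0 <;> simp [hx]
    simp_rw [h1]
    rw [Finset.sum_sub_distrib]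
    simp
  · intro i hi
    have h0 : 1 < p ^ (i + 1) := Nat.one_lt_pow (by omega) hp
    have hlt : p ^ (i + 1) < p ^ (N + 1) :=
      Nat.pow_lt_pow_right hp (by have := Finset.mem_range.1 hi; omega)
    rw [← FiniteField.sum_pow_lt_card_sub_one F (p ^ (i + 1) - 1) (by omega)]
    refine Finset.sum_congr rfl fun x _ => ?_
    by_cases hx : x = 0
    · simp [hx, zero_pow (by omega : p ^ (i + 1) - 1 ≠ 0)]
    · rw [inv_mul_eq_iff_eq_mul₀ hx, ← pow_succ']
      congr 1
      omega

/-- Expand $\zeta^{\mathrm{Tr}\,x}$ to second order in $1-\zeta$. The constant term drops out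
because the character is nontrivial (hence $|F|>2$), and the linear coefficient is a unit, since up
to sign it reduces to $\sum_x x^{-1}\mathrm{Tr}\,x=-1$. -/
theorem le_norm_gaussSum_inv {T : F →*₀ ℂ_[p]} (hT : IsMultiplicativeLift T)
    (hcard : 2 < Fintype.card F) :
    ‖1 - ζ‖ ≤ ‖gaussSum (mulCharOfHom T)⁻¹ (traceChar F hζ)‖ := by
  choose w hw hexp using exists_pow_eq_expansion (norm_root_eq_one hζ).le
  set χ := (mulCharOfHom T)⁻¹ with hχ
  let t : F → ℕ := fun x => (Algebra.trace (ZMod p) F x).val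
  have hχ1 : χ ≠ 1 := fun h => by
    have h' := (hT.inv_pow_eq_one_iff 1).1 (by rw [pow_one]; exact h)
    have := Nat.le_of_dvd one_pos h'
    omega
  have hsum : gaussSum χ (traceChar F hζ) =
      (1 - ζ) * (-(∑ x, χ x * t x) + (1 - ζ) * ∑ x, χ x * w (t x)) := by
    have h1 : ∀ x, χ x * traceChar F hζ x =
        χ x + (1 - ζ) * (-(χ x * t x)) + (1 - ζ) * ((1 - ζ) * (χ x * w (t x))) := by
      intro x
      rw [traceChar_apply, hexp]
      ring
    rw [gaussSum, Finset.sum_congr rfl fun x _ => h1 x, Finset.sum_add_distrib,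
      Finset.sum_add_distrib, χ.sum_eq_zero_of_ne_one hχ1, ← Finset.mul_sum, ← Finset.mul_sum,
      ← Finset.mul_sum, Finset.sum_neg_distrib]
    ring
  have hmain : 1 ≤ ‖∑ x, χ x * t x‖ := by
    by_contra! hlt
    -- Substituting $x\mapsto x^{-1}$ turns the sum into an integral combination of values of `T`,
    -- the form to which `hT` applies.
    have hre : ∑ x, χ x * t x = ∑ x, ((t x⁻¹ : ℤ) : ℂ_[p]) * T x := by
      rw [← Equiv.sum_comp (Equiv.inv F)]
      refine Finset.sum_congr rfl fun x _ => ?_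
      rw [hχ, MulChar.inv_apply', Equiv.inv_apply, inv_inv, mulCharOfHom_apply, mul_comm,
        Int.cast_natCast]
    rw [hre] at hlt
    have h0 := hT _ hlt
    have hs := sum_inv_mul_trace (p := p) hcard
    rw [← Equiv.sum_comp (Equiv.inv F)] at hs
    refine one_ne_zero (α := F) (neg_eq_zero.1 (hs.symm.trans (Eq.trans ?_ h0)))
    refine Finset.sum_congr rfl fun x _ => ?_
    rw [Equiv.inv_apply, inv_inv, mul_comm, Int.cast_natCast]
    congr 1
    rw [← map_natCast (algebraMap (ZMod p) F), ZMod.natCast_zmod_val]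
  have hsmall : ‖(1 - ζ) * ∑ x, χ x * w (t x)‖ < 1 := by
    rw [norm_mul]
    refine mul_lt_one_of_nonneg_of_lt_one_left (norm_nonneg _) (norm_one_sub_root_lt_one hζ)
      (norm_sum_le_one _ fun x _ => ?_)
    rw [norm_mul]
    exact mul_le_one₀ (norm_mulChar_le_one χ x) (norm_nonneg _) (hw _)
  rw [hsum, norm_mul]
  refine le_mul_of_one_le_right (norm_nonneg _) ?_
  rw [← norm_neg] at hmain
  rw [IsUltrametricDist.norm_add_eq_max_of_norm_ne_norm (hsmall.trans_le hmain).ne']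
  exact le_max_of_le_left hmain

/-- Substitute $x\mapsto x^p$: the trace is Frobenius invariant. -/
theorem gaussSum_pow_char (χ : MulChar F ℂ_[p]) :
    gaussSum (χ ^ p) (traceChar F hζ) = gaussSum χ (traceChar F hζ) := by
  have hp := (Fact.out : p.Prime).ne_zero
  rw [gaussSum, gaussSum,
    ← (FiniteField.frobeniusAlgEquivOfAlgebraic (ZMod p) F).toEquiv.sum_comp
      fun y => χ y * traceChar F hζ y]
  refine Finset.sum_congr rfl fun x _ => ?_
  have : (FiniteField.frobeniusAlgEquivOfAlgebraic (ZMod p) F).toEquiv x = x ^ p := by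
    change FiniteField.frobeniusAlgEquivOfAlgebraic (ZMod p) F x = _
    rw [FiniteField.coe_frobeniusAlgEquivOfAlgebraic, ZMod.card]
  rw [this, traceChar_pow, map_pow, MulChar.pow_apply' _ hp]

/-- The easy half of Stickelberger's theorem. -/
theorem pow_digitSum_le_norm_gaussSum {T : F →*₀ ℂ_[p]} (hT : IsMultiplicativeLift T) (r : ℕ)
    (hr : r < Fintype.card F - 1) :
    ‖1 - ζ‖ ^ digitSum p r ≤ ‖gaussSum ((mulCharOfHom T)⁻¹ ^ r) (traceChar F hζ)‖ := by
  have hp := (Fact.out : p.Prime).one_lt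
  induction r using Nat.strong_induction_on with
  | _ r ih =>
    rcases Nat.eq_zero_or_pos r with rfl | hr0
    · rw [pow_zero, gaussSum_one_left (traceChar_ne_one hζ), digitSum_zero, pow_zero, norm_neg,
        norm_one]
    have hdm : p * (r / p) + r % p = r := Nat.div_add_mod r p
    -- A last digit $0$ is removed by Frobenius. Otherwise lower it by one:
    -- $g(T^{-1})\,g(T^{-(r-1)})$ is $g(T^{-r})$ times a Jacobi sum, which is integral.
    by_cases hmod : r % p = 0
    · have hd := Nat.div_lt_self hr0 hp
      have h1 : r = r / p * p := by rw [mul_comm]; omega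
      have h2 : digitSum p r = digitSum p (r / p) := by
        conv_lhs => rw [← hdm, hmod]
        rw [digitSum_mul_add hp _ (by omega), zero_add]
      rw [h2]
      conv_rhs => rw [h1, pow_mul, gaussSum_pow_char]
      exact ih _ hd (by omega)
    · have h2 : digitSum p r = 1 + digitSum p (r - 1) := by
        have hlt := Nat.mod_lt r (by omega : p > 0)
        have e1 : r - 1 = p * (r / p) + (r % p - 1) := by omega
        rw [e1, digitSum_mul_add hp _ (by omega)]
        conv_lhs => rw [← hdm]
        rw [digitSum_mul_add hp _ hlt]
        omega
      have hne : (mulCharOfHom T)⁻¹ * (mulCharOfHom T)⁻¹ ^ (r - 1) ≠ 1 := by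
        rw [← pow_succ', Nat.sub_add_cancel hr0, ne_eq, hT.inv_pow_eq_one_iff]
        exact Nat.not_dvd_of_pos_of_lt hr0 hr
      have hmul := jacobiSum_mul_nontrivial hne (traceChar F hζ)
      rw [← pow_succ', Nat.sub_add_cancel hr0] at hmul
      rw [h2, pow_add, pow_one]
      calc _ ≤ ‖gaussSum (mulCharOfHom T)⁻¹ (traceChar F hζ)‖ *
            ‖gaussSum ((mulCharOfHom T)⁻¹ ^ (r - 1)) (traceChar F hζ)‖ :=
            mul_le_mul (le_norm_gaussSum_inv hζ hT (by omega)) (ih _ (by omega) (by omega))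
              (by positivity) (norm_nonneg _)
        _ = ‖gaussSum ((mulCharOfHom T)⁻¹ ^ r) (traceChar F hζ)‖ *
            ‖jacobiSum (mulCharOfHom T)⁻¹ ((mulCharOfHom T)⁻¹ ^ (r - 1))‖ := by
            rw [← norm_mul, ← norm_mul, hmul]
        _ ≤ _ := mul_le_of_le_one_right (norm_nonneg _) (norm_jacobiSum_le_one _ _)

/-- Stickelberger's theorem on the valuation of Gauss sums. -/
theorem norm_gaussSum_inv_pow {T : F →*₀ ℂ_[p]} (hT : IsMultiplicativeLift T) {r : ℕ}
    (hr : r < Fintype.card F - 1) :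
    ‖gaussSum ((mulCharOfHom T)⁻¹ ^ r) (traceChar F hζ)‖ = ‖1 - ζ‖ ^ digitSum p r := by
  have hp := (Fact.out : p.Prime).one_lt
  rcases Nat.eq_zero_or_pos r with rfl | hr0
  · rw [pow_zero, gaussSum_one_left (traceChar_ne_one hζ), digitSum_zero, pow_zero, norm_neg,
      norm_one]
  set χ := (mulCharOfHom T)⁻¹ with hχ
  set s := Fintype.card F - 1 - r with hs
  have hne : χ ^ r ≠ 1 := by
    rw [ne_eq, hT.inv_pow_eq_one_iff]
    exact Nat.not_dvd_of_pos_of_lt hr0 hr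
  have hinv : (χ ^ r)⁻¹ = χ ^ s := by
    rw [inv_eq_iff_mul_eq_one, ← pow_add, hT.inv_pow_eq_one_iff]
    exact dvd_of_eq (by omega)
  have hunit : ‖(χ ^ s) (-1)‖ = 1 := by
    have h1 : ((χ ^ s) (-1)) ^ 2 = 1 := by rw [← map_pow, neg_one_sq, map_one]
    exact (pow_eq_one_iff_of_nonneg (norm_nonneg _) two_ne_zero).1
      (by rw [← norm_pow, h1, norm_one])
  -- The product of Gauss sums of inverse characters is $|F|$ up to sign, and the digit sums of `r`
  -- and `s` add up to exactly its valuation times $p-1$. So neither lower bound can be strict.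
  have hprod : ‖gaussSum (χ ^ r) (traceChar F hζ)‖ * ‖gaussSum (χ ^ s) (traceChar F hζ)‖ =
      ‖1 - ζ‖ ^ digitSum p r * ‖1 - ζ‖ ^ digitSum p s := by
    have h1 := gaussSum_mul_gaussSum_eq_card hne
      (AddChar.IsPrimitive.of_ne_one (traceChar_ne_one (F := F) hζ))
    have h2 := mul_gaussSum_inv_eq_gaussSum (χ ^ s) (traceChar F hζ)
    have hF : Fintype.card F = p ^ Module.finrank (ZMod p) F := by
      rw [Module.card_eq_pow_finrank (K := ZMod p), ZMod.card]
    rw [hinv] at h1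
    rw [← h2, norm_mul, hunit, one_mul, ← norm_mul, h1, ← pow_add,
      digitSum_add_digitSum hp (N := Module.finrank (ZMod p) F) (by rw [← hF]; omega), pow_mul,
      norm_one_sub_pow_pred hζ, hF, Nat.cast_pow, norm_pow]
  have hpos : 0 < ‖1 - ζ‖ :=
    norm_pos_iff.2 (sub_ne_zero.2 (hζ.ne_one hp).symm)
  have hl1 := pow_digitSum_le_norm_gaussSum hζ hT r hr
  have hl2 := pow_digitSum_le_norm_gaussSum hζ hT s (by omega)
  refine le_antisymm ?_ hl1
  by_contra! hlt
  exact hprod.not_gt (mul_lt_mul_of_pos_of_nonneg' hlt hl2 (by positivity) (norm_nonneg _))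

end GaussSum

/-! ### Interpolation at Teichmüller points -/

section Interpolation

variable {p : ℕ} [Fact p.Prime] {F : Type*} [Field F] [Fintype F]

open Classical in
/-- The coefficients of the linear functional that extracts the coefficient of `X ^ r` from the
values of a polynomial of degree less than `|F|` at the multiplicative lifts of the elements
of `F`. -/
noncomputable def interpCoeff (T : F →*₀ ℂ_[p]) (r : ℕ) (a : F) : ℂ_[p] :=
  (if a = 0 then (if r = 0 then 1 else if r = Fintype.card F - 1 then -1 else 0) else 0) +
    if r = 0 then 0
    else ((Fintype.card F - 1 : ℕ) : ℂ_[p])⁻¹ * ((mulCharOfHom T)⁻¹ ^ r) a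

theorem card_sub_one_ne_zero : ((Fintype.card F - 1 : ℕ) : ℂ_[p]) ≠ 0 := by
  have := Fintype.one_lt_card (α := F)
  exact Nat.cast_ne_zero.2 (by omega)

theorem norm_card_sub_one [CharP F p] : ‖((Fintype.card F - 1 : ℕ) : ℂ_[p])‖ = 1 := by
  refine norm_natCast_eq_one fun h => ?_
  have h1 : p ∣ Fintype.card F := (CharP.cast_eq_zero_iff F p _).1 (Nat.cast_card_eq_zero F)
  have h2 := (Nat.dvd_sub_iff_right Fintype.card_pos h1).1 h
  exact (Fact.out : p.Prime).one_lt.ne' (Nat.dvd_one.1 h2)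

theorem norm_interpCoeff_le_one [CharP F p] (T : F →*₀ ℂ_[p]) (r : ℕ) (a : F) :
    ‖interpCoeff T r a‖ ≤ 1 := by
  refine (IsUltrametricDist.norm_add_le_max _ _).trans (max_le ?_ ?_)
  · split_ifs <;> simp
  · split_ifs
    · simp
    · rw [norm_mul, norm_inv, norm_card_sub_one, inv_one, one_mul]
      exact norm_mulChar_le_one _ _

theorem sum_interpCoeff_mul (T : F →*₀ ℂ_[p]) (r : ℕ) (f : F → ℂ_[p]) :
    ∑ a, interpCoeff T r a * f a =
      (if r = 0 then 1 else if r = Fintype.card F - 1 then -1 else 0) * f 0 +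
      if r = 0 then 0
      else ((Fintype.card F - 1 : ℕ) : ℂ_[p])⁻¹ * ∑ a, ((mulCharOfHom T)⁻¹ ^ r) a * f a := by
  classical
  simp only [interpCoeff, add_mul, Finset.sum_add_distrib]
  congr 1
  · simp only [ite_mul, zero_mul, Finset.sum_ite_eq', Finset.mem_univ, if_true]
  · split_ifs
    · simp
    · simp only [mul_assoc, Finset.mul_sum]

/-- Subtraction is truncated, so one of the two divisibilities is always trivial; together they say
$r\equiv s$ modulo $|F|-1$. -/
theorem IsMultiplicativeLift.inv_pow_mul_pow_eq_one_iff {T : F →*₀ ℂ_[p]}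
    (hT : IsMultiplicativeLift T) {r s : ℕ} :
    (mulCharOfHom T)⁻¹ ^ r * mulCharOfHom T ^ s = 1 ↔
      Fintype.card F - 1 ∣ r - s ∧ Fintype.card F - 1 ∣ s - r := by
  rcases le_total r s with h | h
  · obtain ⟨d, rfl⟩ := Nat.exists_eq_add_of_le h
    rw [pow_add, inv_pow, inv_mul_cancel_left, ← inv_eq_one, ← inv_pow, hT.inv_pow_eq_one_iff,
      Nat.sub_eq_zero_of_le h, Nat.add_sub_cancel_left]
    simp
  · obtain ⟨d, rfl⟩ := Nat.exists_eq_add_of_le h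
    rw [add_comm s d, pow_add, mul_assoc, inv_pow _ s, inv_mul_cancel, mul_one,
      hT.inv_pow_eq_one_iff, Nat.add_sub_cancel_right, Nat.sub_eq_zero_of_le (Nat.le_add_left _ _)]
    simp

theorem sum_inv_pow_mul_pow {T : F →*₀ ℂ_[p]} (hT : IsMultiplicativeLift T) {r s : ℕ} :
    ∑ a, ((mulCharOfHom T)⁻¹ ^ r) a * T a ^ s =
      if Fintype.card F - 1 ∣ r - s ∧ Fintype.card F - 1 ∣ s - r
      then ((Fintype.card F - 1 : ℕ) : ℂ_[p]) else 0 := by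
  classical
  have h1 : ∀ a, ((mulCharOfHom T)⁻¹ ^ r) a * T a ^ s =
      ((mulCharOfHom T)⁻¹ ^ r * mulCharOfHom T ^ s) a := by
    intro a
    rw [MulChar.mul_apply]
    -- Both sides vanish at $0$, even for exponent $0$: the trivial character is $0$ there.
    by_cases ha : a = 0
    · simp [ha, MulChar.map_zero]
    · have h := MulChar.pow_apply_coe (mulCharOfHom T) s (Units.mk0 a ha)
      rw [Units.val_mk0] at h
      rw [h, mulCharOfHom_apply]
  rw [Finset.sum_congr rfl fun a _ => h1 a]
  split_ifs with h
  · rw [hT.inv_pow_mul_pow_eq_one_iff.2 h, MulChar.sum_one_eq_card_units, Fintype.card_units]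
  · exact MulChar.sum_eq_zero_of_ne_one fun h' => h (hT.inv_pow_mul_pow_eq_one_iff.1 h')

/-- Orthogonality on $F^\times$ cannot separate the exponents $0$ and $|F|-1$. The value at $0$
does: it is the constant coefficient, and it is subtracted from the top one. -/
theorem sum_interpCoeff_mul_pow {T : F →*₀ ℂ_[p]} (hT : IsMultiplicativeLift T) {r s : ℕ}
    (hr : r < Fintype.card F) (hs : s < Fintype.card F) :
    ∑ a, interpCoeff T r a * T a ^ s = if r = s then 1 else 0 := by
  have hF := Fintype.one_lt_card (α := F)
  have hne := card_sub_one_ne_zero (p := p) (F := F)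
  rw [sum_interpCoeff_mul, sum_inv_pow_mul_pow hT, map_zero]
  by_cases h0 : r = 0
  · subst h0
    by_cases hs0 : s = 0
    · simp [hs0]
    · simp [hs0, Ne.symm hs0]
  have hsmall : ∀ d, d < Fintype.card F - 1 → (Fintype.card F - 1 ∣ d ↔ d = 0) := fun d hd =>
    ⟨fun h => Nat.eq_zero_of_dvd_of_lt h hd, fun h => h ▸ dvd_zero _⟩
  have hsr := hsmall (s - r) (by omega)
  rw [if_neg h0, if_neg h0]
  by_cases h1 : r = Fintype.card F - 1
  · rw [if_pos h1]
    by_cases hs0 : s = 0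
    · have : Fintype.card F - 1 ∣ r - s ∧ Fintype.card F - 1 ∣ s - r :=
        ⟨by rw [hs0, h1, Nat.sub_zero], hsr.2 (by omega)⟩
      rw [if_pos this, hs0, pow_zero, inv_mul_cancel₀ hne, if_neg h0]
      ring
    · have hrs' := hsmall (r - s) (by omega)
      rw [zero_pow hs0]
      by_cases hrs : r = s
      · rw [if_pos ⟨hrs'.2 (by omega), hsr.2 (by omega)⟩, if_pos hrs, inv_mul_cancel₀ hne]
        ring
      · rw [if_neg (by rw [hrs', hsr]; omega), if_neg hrs]
        ring
  · have hrs' := hsmall (r - s) (by omega)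
    rw [if_neg h1, zero_mul, zero_add]
    by_cases hrs : r = s
    · rw [if_pos ⟨hrs'.2 (by omega), hsr.2 (by omega)⟩, if_pos hrs, inv_mul_cancel₀ hne]
    · rw [if_neg (by rw [hrs', hsr]; omega), if_neg hrs, mul_zero]

/-- Every function on `F` is a polynomial of degree less than `|F|` in the multiplicative lift. -/
theorem eq_sum_interpCoeff {T : F →*₀ ℂ_[p]} (hT : IsMultiplicativeLift T) (f : F → ℂ_[p])
    (x : F) :
    f x = ∑ r : Fin (Fintype.card F), (∑ a, interpCoeff T r a * f a) * T x ^ (r : ℕ) := by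
  classical
  let D : Matrix (Fin (Fintype.card F)) F ℂ_[p] := fun r a => interpCoeff T r a
  let V : Matrix F (Fin (Fintype.card F)) ℂ_[p] := fun a s => T a ^ (s : ℕ)
  have hDV : D * V = 1 := by
    ext r s
    rw [Matrix.mul_apply, sum_interpCoeff_mul_pow hT r.2 s.2, Matrix.one_apply]
    simp only [Fin.ext_iff]
  -- The matrices are square up to reindexing, so the left inverse of the Vandermonde matrix is a
  -- right inverse.
  have hVD : V * D = 1 := (Matrix.mul_eq_one_comm_of_card_eq _ _ _ (by simp)).1 hDV
  have h := congrFun (congrArg (fun M => M.mulVec f) hVD) x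
  simp only [Matrix.one_mulVec, ← Matrix.mulVec_mulVec] at h
  rw [← h]
  simp only [Matrix.mulVec, dotProduct, V, D, mul_comm]

variable {k : ℕ}

theorem sum_prod_interpCoeff_mul {T : F →*₀ ℂ_[p]} (hT : IsMultiplicativeLift T)
    (c : (Fin k → Fin (Fintype.card F)) → ℂ_[p]) (r : Fin k → Fin (Fintype.card F)) :
    ∑ a : Fin k → F, (∏ i, interpCoeff T (r i) (a i)) * ∑ s, c s * ∏ i, T (a i) ^ (s i : ℕ) =
      c r := by
  classical
  have h1 : ∀ s : Fin k → Fin (Fintype.card F),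
      ∑ a : Fin k → F, ∏ i, (interpCoeff T (r i) (a i) * T (a i) ^ (s i : ℕ)) =
        if r = s then 1 else 0 := by
    intro s
    have h := Finset.prod_univ_sum (fun _ : Fin k => (Finset.univ : Finset F))
      (fun i x => interpCoeff T (r i) x * T x ^ (s i : ℕ))
    rw [Fintype.piFinset_univ] at h
    rw [← h, Finset.prod_congr rfl fun i _ => sum_interpCoeff_mul_pow hT (r i).2 (s i).2]
    simp only [← Fin.ext_iff]
    by_cases hrs : r = s
    · simp [hrs]
    · obtain ⟨i, hi⟩ := Function.ne_iff.1 hrs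
      rw [if_neg hrs]
      exact Finset.prod_eq_zero (Finset.mem_univ i) (if_neg hi)
  calc _ = ∑ a : Fin k → F, ∑ s, c s *
        ∏ i, (interpCoeff T (r i) (a i) * T (a i) ^ (s i : ℕ)) := by
        refine Finset.sum_congr rfl fun a _ => ?_
        rw [Finset.mul_sum]
        refine Finset.sum_congr rfl fun s _ => ?_
        rw [Finset.prod_mul_distrib]
        ring
    _ = ∑ s, c s * if r = s then 1 else 0 := by
        rw [Finset.sum_comm]
        simp only [← Finset.mul_sum, h1]
    _ = c r := by simp

/-- The coefficients of a polynomial that has degree less than `|F|` in each variable are bounded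
by its values at the multiplicative lifts. -/
theorem norm_coeff_le [CharP F p] {T : F →*₀ ℂ_[p]} (hT : IsMultiplicativeLift T)
    (c : (Fin k → Fin (Fintype.card F)) → ℂ_[p]) {B : ℝ}
    (hB : ∀ a : Fin k → F, ‖∑ s, c s * ∏ i, T (a i) ^ (s i : ℕ)‖ ≤ B)
    (r : Fin k → Fin (Fintype.card F)) : ‖c r‖ ≤ B := by
  rw [← sum_prod_interpCoeff_mul hT c r]
  refine IsUltrametricDist.norm_sum_le_of_forall_le_of_nonneg
    ((norm_nonneg _).trans (hB 0)) fun a _ => ?_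
  rw [norm_mul, norm_prod]
  exact (mul_le_of_le_one_left (norm_nonneg _) (Finset.prod_le_one (fun _ _ => norm_nonneg _)
    fun i _ => norm_interpCoeff_le_one T _ _)).trans (hB a)

/-- Converse of `norm_coeff_le`: Teichmüller points are integral. -/
theorem norm_eval_le (T : F →*₀ ℂ_[p]) (c : (Fin k → Fin (Fintype.card F)) → ℂ_[p]) {B : ℝ}
    (hB : ∀ s, ‖c s‖ ≤ B) (hB0 : 0 ≤ B) (a : Fin k → F) :
    ‖∑ s, c s * ∏ i, T (a i) ^ (s i : ℕ)‖ ≤ B := by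
  refine IsUltrametricDist.norm_sum_le_of_forall_le_of_nonneg hB0 fun s _ => ?_
  rw [norm_mul, norm_prod]
  refine (mul_le_of_le_one_right (norm_nonneg _) (Finset.prod_le_one (fun _ _ => norm_nonneg _)
    fun i _ => ?_)).trans (hB s)
  rw [norm_pow]
  exact pow_le_one₀ (norm_nonneg _) (norm_hom_le_one T _)

end Interpolation

/-! ### The additive character as a polynomial -/

section CharacterExpansion

variable {p : ℕ} [Fact p.Prime] {F : Type*} [Field F] [Fintype F] [Algebra (ZMod p) F]
  {ζ : ℂ_[p]} (hζ : IsPrimitiveRoot ζ p)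

/-- The coefficients of the additive character of `F` as a polynomial in the multiplicative
lift. -/
noncomputable def charCoeff (T : F →*₀ ℂ_[p]) (r : ℕ) : ℂ_[p] :=
  ∑ a, interpCoeff T r a * traceChar F hζ a

theorem charCoeff_zero (T : F →*₀ ℂ_[p]) : charCoeff hζ T 0 = 1 := by
  rw [charCoeff, sum_interpCoeff_mul]
  simp

theorem norm_charCoeff {T : F →*₀ ℂ_[p]} (hT : IsMultiplicativeLift T) {r : ℕ}
    (hr : r < Fintype.card F) : ‖charCoeff hζ T r‖ = ‖1 - ζ‖ ^ digitSum p r := by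
  have hchar : CharP F p := charP_of_injective_algebraMap' (ZMod p) p
  have hne := card_sub_one_ne_zero (p := p) (F := F)
  have hF1 := Fintype.one_lt_card (α := F)
  by_cases h0 : r = 0
  · rw [h0, charCoeff_zero, norm_one, digitSum_zero, pow_zero]
  rw [charCoeff, sum_interpCoeff_mul, if_neg h0, if_neg h0, AddChar.map_zero_eq_one, mul_one]
  change ‖_ + _ * gaussSum ((mulCharOfHom T)⁻¹ ^ r) (traceChar F hζ)‖ = _
  by_cases h1 : r = Fintype.card F - 1
  · have hone : (mulCharOfHom T)⁻¹ ^ r = 1 := (hT.inv_pow_eq_one_iff r).2 (dvd_of_eq h1.symm)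
    have hF : Fintype.card F = p ^ Module.finrank (ZMod p) F := by
      rw [Module.card_eq_pow_finrank (K := ZMod p), ZMod.card]
    have hdig : digitSum p r = (p - 1) * Module.finrank (ZMod p) F := by
      have := digitSum_add_digitSum (Fact.out : p.Prime).one_lt
        (N := Module.finrank (ZMod p) F) (a := r) (b := 0) (by omega)
      rwa [digitSum_zero, add_zero] at this
    -- At the top exponent the correction at $0$ makes the coefficient $-|F|/(|F|-1)$, matching the
    -- all-$(p-1)$ digits of $|F|-1$.
    have hval : (-1 : ℂ_[p]) + ((Fintype.card F - 1 : ℕ) : ℂ_[p])⁻¹ * -1 =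
        -(((Fintype.card F - 1 : ℕ) : ℂ_[p])⁻¹ * (Fintype.card F : ℂ_[p])) := by
      have : (Fintype.card F : ℂ_[p]) = ((Fintype.card F - 1 : ℕ) : ℂ_[p]) + 1 := by
        rw [← Nat.cast_succ, Nat.succ_eq_add_one, Nat.sub_add_cancel hF1.le]
      rw [this]
      field_simp
      ring
    rw [if_pos h1, hone, gaussSum_one_left (traceChar_ne_one hζ), hval, norm_neg, norm_mul,
      norm_inv, norm_card_sub_one, inv_one, one_mul, hdig, pow_mul, norm_one_sub_pow_pred hζ, hF,
      Nat.cast_pow, norm_pow]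
  · rw [if_neg h1, zero_add, norm_mul, norm_inv, norm_card_sub_one, inv_one, one_mul,
      norm_gaussSum_inv_pow hζ hT (by omega)]

theorem traceChar_sum_eq {T : F →*₀ ℂ_[p]} (hT : IsMultiplicativeLift T) {k : ℕ}
    (y : Fin k → F) :
    traceChar F hζ (∑ i, y i) = ∑ r : Fin k → Fin (Fintype.card F),
      (∏ i, charCoeff hζ T (r i)) * ∏ i, T (y i) ^ (r i : ℕ) := by
  classical
  have h := Finset.prod_univ_sum
    (fun _ : Fin k => (Finset.univ : Finset (Fin (Fintype.card F))))
    (fun i r => charCoeff hζ T r * T (y i) ^ (r : ℕ))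
  rw [Fintype.piFinset_univ] at h
  simp only [← Finset.prod_mul_distrib]
  have hsum : traceChar F hζ (∑ i, y i) = ∏ i, traceChar F hζ (y i) :=
    map_prod (traceChar F hζ).toMonoidHom (fun i => Multiplicative.ofAdd (y i)) Finset.univ
  rw [hsum, ← h]
  exact Finset.prod_congr rfl fun i _ => eq_sum_interpCoeff hT (traceChar F hζ) (y i)

end CharacterExpansion

/-! ### Weights of trace codewords as a polynomial -/

section WeightFormula

variable {p : ℕ} [Fact p.Prime] {K F : Type*} [Field K] [Fintype K] [DecidableEq K]

theorem sum_units_eq (f : K → ℂ_[p]) : ∑ b : Kˣ, f b = ∑ b, f b - f 0 := by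
  classical
  rw [Fintype.sum_eq_add_sum_subtype_ne f 0, add_sub_cancel_left]
  exact unitsEquivNeZero.sum_comp fun b : {b : K // b ≠ 0} => f b

variable [Field F] [Fintype F] [Algebra K F]

theorem sum_units_pow {T : F →*₀ ℂ_[p]} (hT : IsMultiplicativeLift T) (s : ℕ) :
    ∑ b : Kˣ, T (algebraMap K F b) ^ s =
      if Fintype.card K - 1 ∣ s then ((Fintype.card K - 1 : ℕ) : ℂ_[p]) else 0 := by
  classical
  let f : Kˣ →* ℂ_[p] :=
    ((T : F →* ℂ_[p]).comp ((algebraMap K F : K →* F).comp (Units.coeHom K))) ^ s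
  have hf : f = 1 ↔ Fintype.card K - 1 ∣ s := by
    rw [← FiniteField.forall_pow_eq_one_iff, DFunLike.ext_iff]
    refine forall_congr' fun b => ?_
    change T (algebraMap K F b) ^ s = 1 ↔ _
    rw [← map_pow, ← map_pow, ← map_one T, hT.injective.eq_iff, ← map_one (algebraMap K F),
      (algebraMap K F).injective.eq_iff, Units.ext_iff, Units.val_pow_eq_pow_val, Units.val_one]
  have h := sum_hom_units f
  simp only [hf, Fintype.card_units] at h
  rw [← Nat.cast_zero, ← apply_ite Nat.cast]
  exact h

variable [Algebra (ZMod p) K] [Algebra (ZMod p) F] [IsScalarTower (ZMod p) K F]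
  {ζ : ℂ_[p]} (hζ : IsPrimitiveRoot ζ p)

/-- Detecting the elements of trace zero by character sums. -/
theorem sum_units_traceChar (y : F) :
    ∑ b : Kˣ, traceChar F hζ (algebraMap K F b * y) =
      ((Fintype.card K - 1 : ℕ) : ℂ_[p]) -
        Fintype.card K * if Algebra.trace K F y ≠ 0 then 1 else 0 := by
  -- Transitivity of the trace reduces the sum to orthogonality of additive characters on `K`.
  have h1 : ∀ b : K, traceChar F hζ (algebraMap K F b * y) =
      traceChar K hζ (b * Algebra.trace K F y) := by
    intro b
    rw [traceChar_apply, traceChar_apply, ← Algebra.trace_trace (S := K), ← Algebra.smul_def,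
      map_smul, smul_eq_mul]
  rw [sum_units_eq fun b => traceChar F hζ (algebraMap K F b * y)]
  simp only [h1, zero_mul, AddChar.map_zero_eq_one]
  rw [AddChar.sum_mulShift _ (AddChar.IsPrimitive.of_ne_one (traceChar_ne_one hζ)),
    Nat.cast_sub Fintype.card_pos]
  split_ifs <;> simp_all

/-- The power sum of the columns of a matrix with exponent vector `r`. -/
noncomputable def columnSum (T : F →*₀ ℂ_[p]) {k n : ℕ} (G : Matrix (Fin k) (Fin n) F)
    (r : Fin k → ℕ) : ℂ_[p] :=
  ∑ j, ∏ i, T (G i j) ^ r i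

/-- The coefficients of the weight function of a trace code as a polynomial in the multiplicative
lifts of the coordinates of a message. -/
noncomputable def weightCoeff (K : Type*) [Fintype K] (T : F →*₀ ℂ_[p]) {k n : ℕ}
    (G : Matrix (Fin k) (Fin n) F) (r : Fin k → ℕ) : ℂ_[p] :=
  if 0 < ∑ i, r i ∧ Fintype.card K - 1 ∣ ∑ i, r i then
    (∏ i, charCoeff hζ T (r i)) * columnSum T G r
  else 0

theorem norm_prod_charCoeff {T : F →*₀ ℂ_[p]} (hT : IsMultiplicativeLift T) {k : ℕ}
    (r : Fin k → ℕ) (hr : ∀ i, r i < Fintype.card F) :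
    ‖∏ i, charCoeff hζ T (r i)‖ = ‖1 - ζ‖ ^ ∑ i, digitSum p (r i) := by
  rw [norm_prod, Finset.prod_congr rfl fun i _ => norm_charCoeff hζ hT (hr i),
    Finset.prod_pow_eq_pow_sum]

/-- The same character sum over positions and $K^\times$ is computed twice: by trace detection
(`hX`) and by the polynomial expansion (`hY`). -/
theorem sum_weightCoeff {T : F →*₀ ℂ_[p]} (hT : IsMultiplicativeLift T) {k n : ℕ}
    (G : Matrix (Fin k) (Fin n) F) (a : Fin k → F) :
    ((Fintype.card K - 1 : ℕ) : ℂ_[p]) * ∑ r : Fin k → Fin (Fintype.card F),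
        weightCoeff hζ K T G (fun i => r i) * ∏ i, T (a i) ^ (r i : ℕ) =
      -(Fintype.card K * (hammingNorm fun j => Algebra.trace K F (∑ i, a i * G i j) : ℂ_[p])) := by
  set κ : ℂ_[p] := ((Fintype.card K - 1 : ℕ) : ℂ_[p]) with hκ
  let r₀ : Fin k → Fin (Fintype.card F) := fun _ => ⟨0, Fintype.card_pos⟩
  have hX : ∑ j, ∑ b : Kˣ, traceChar F hζ (algebraMap K F b * ∑ i, a i * G i j) =
      n * κ - Fintype.card K *
        (hammingNorm fun j => Algebra.trace K F (∑ i, a i * G i j) : ℂ_[p]) := by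
    simp only [sum_units_traceChar, Finset.sum_sub_distrib, ← Finset.mul_sum, hammingNorm,
      Finset.sum_boole]
    simp [hκ]
  have hY : ∑ j, ∑ b : Kˣ, traceChar F hζ (algebraMap K F b * ∑ i, a i * G i j) =
      ∑ r : Fin k → Fin (Fintype.card F), (∑ b : Kˣ, T (algebraMap K F b) ^ ∑ i, (r i : ℕ)) *
        ((∏ i, charCoeff hζ T (r i)) * columnSum T G (fun i => r i) *
          ∏ i, T (a i) ^ (r i : ℕ)) := by
    have h1 : ∀ j, ∀ b : Kˣ, traceChar F hζ (algebraMap K F b * ∑ i, a i * G i j) =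
        ∑ r : Fin k → Fin (Fintype.card F), T (algebraMap K F b) ^ (∑ i, (r i : ℕ)) *
          ((∏ i, charCoeff hζ T (r i)) * (∏ i, T (G i j) ^ (r i : ℕ)) *
            ∏ i, T (a i) ^ (r i : ℕ)) := by
      intro j b
      rw [Finset.mul_sum, traceChar_sum_eq hζ hT]
      refine Finset.sum_congr rfl fun r _ => ?_
      simp only [map_mul, mul_pow, Finset.prod_mul_distrib, Finset.prod_pow_eq_pow_sum]
      ring
    simp only [h1]
    rw [Finset.sum_congr rfl fun j _ => Finset.sum_comm (s := (Finset.univ : Finset Kˣ)),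
      Finset.sum_comm]
    refine Finset.sum_congr rfl fun r _ => ?_
    rw [Finset.sum_comm, Finset.sum_mul]
    refine Finset.sum_congr rfl fun b _ => ?_
    rw [columnSum, Finset.mul_sum, Finset.sum_mul, Finset.mul_sum]
  have hterm : ∀ r : Fin k → Fin (Fintype.card F),
      (∑ b : Kˣ, T (algebraMap K F b) ^ ∑ i, (r i : ℕ)) *
        ((∏ i, charCoeff hζ T (r i)) * columnSum T G (fun i => r i) *
          ∏ i, T (a i) ^ (r i : ℕ)) =
      κ * (weightCoeff hζ K T G (fun i => r i) * ∏ i, T (a i) ^ (r i : ℕ)) +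
        if r = r₀ then n * κ else 0 := by
    intro r
    rw [sum_units_pow hT, weightCoeff]
    by_cases hr : r = r₀
    · simp [hr, r₀, charCoeff_zero, columnSum, hκ, mul_comm]
    · have hpos : 0 < ∑ i, (r i : ℕ) := by
        rw [Nat.pos_iff_ne_zero]
        intro h0
        refine hr (funext fun i => Fin.ext ?_)
        exact Finset.sum_eq_zero_iff.1 h0 i (Finset.mem_univ i)
      simp only [hpos, hr, true_and, if_false, add_zero]
      split_ifs <;> simp [hκ]
  rw [hX, Finset.sum_congr rfl fun r _ => hterm r, Finset.sum_add_distrib, Finset.sum_ite_eq',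
    if_pos (Finset.mem_univ _), ← Finset.mul_sum] at hY
  linear_combination -hY

theorem norm_sum_weightCoeff {T : F →*₀ ℂ_[p]} (hT : IsMultiplicativeLift T) {k n : ℕ}
    (G : Matrix (Fin k) (Fin n) F) (a : Fin k → F) :
    ‖∑ r : Fin k → Fin (Fintype.card F),
        weightCoeff hζ K T G (fun i => r i) * ∏ i, T (a i) ^ (r i : ℕ)‖ =
      ‖(Fintype.card K : ℂ_[p])‖ *
        ‖(hammingNorm fun j => Algebra.trace K F (∑ i, a i * G i j) : ℂ_[p])‖ := by
  have : CharP K p := charP_of_injective_algebraMap' (ZMod p) p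
  have h := congrArg norm (sum_weightCoeff (K := K) hζ hT G a)
  rwa [norm_mul, norm_card_sub_one, one_mul, norm_neg, norm_mul] at h

end WeightFormula

/-! ### The Teichmüller lift is a multiplicative lift -/

section Teichmuller

variable {p : ℕ} [Fact p.Prime] {ξ : ℂ_[p]} {N : ℕ} {F : Type*} [Field F] [Finite F]

theorem exists_teichmullerLift_eq (hF : Nat.card F = p ^ N)
    (hξ : IsPrimitiveRoot ξ (p ^ N - 1)) (ι : ResidueRing p ξ ≃+* F) (a : F) :
    ∃ u ∈ rootSet ξ (Nat.card F), reduction ι u = a ∧ (u : ℂ_[p]) = teichmullerLift ι a := by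
  have h : ∃ u ∈ rootSet ξ (Nat.card F), reduction ι u = a :=
    (reduction_bijOn hF hξ ι).surjOn (Set.mem_univ a)
  exact ⟨_, Function.invFunOn_mem h, Function.invFunOn_eq h, rfl⟩

theorem teichmullerLift_reduction (hF : Nat.card F = p ^ N)
    (hξ : IsPrimitiveRoot ξ (p ^ N - 1)) (ι : ResidueRing p ξ ≃+* F) {u : adjoinInt p ξ}
    (hu : u ∈ rootSet ξ (Nat.card F)) : teichmullerLift ι (reduction ι u) = u := by
  obtain ⟨v, hv, hvu, h⟩ := exists_teichmullerLift_eq hF hξ ι (reduction ι u)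
  rw [← h, (reduction_bijOn hF hξ ι).injOn hv hu hvu]

/-- The Teichmüller lift as a multiplicative map. -/
noncomputable def teichmullerHom (hF : Nat.card F = p ^ N) (hξ : IsPrimitiveRoot ξ (p ^ N - 1))
    (ι : ResidueRing p ξ ≃+* F) : F →*₀ ℂ_[p] where
  toFun := teichmullerLift ι
  map_zero' := by
    have h := teichmullerLift_reduction hF hξ ι (u := 0) (zero_pow Nat.card_pos.ne')
    rwa [map_zero] at h
  map_one' := by
    have h := teichmullerLift_reduction hF hξ ι (u := 1) (one_pow _)
    rwa [map_one] at h
  map_mul' a b := by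
    obtain ⟨u, hu, rfl, hua⟩ := exists_teichmullerLift_eq hF hξ ι a
    obtain ⟨v, hv, rfl, hvb⟩ := exists_teichmullerLift_eq hF hξ ι b
    have huv : u * v ∈ rootSet ξ (Nat.card F) := by
      change (u * v) ^ _ = u * v
      rw [mul_pow]
      exact congrArg₂ _ hu hv
    rw [← map_mul, teichmullerLift_reduction hF hξ ι huv, ← hua, ← hvb, Subring.coe_mul]

/-- An element of $\mathbb{Z}_p[\xi]$ of norm below one is a multiple of $p$, so it reduces to $0$.
-/
theorem isMultiplicativeLift_teichmullerHom [Fintype F] (hF : Nat.card F = p ^ N)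
    (hξ : IsPrimitiveRoot ξ (p ^ N - 1)) (ι : ResidueRing p ξ ≃+* F) :
    IsMultiplicativeLift (teichmullerHom hF hξ ι) := by
  have hN : N ≠ 0 := by
    rintro rfl
    have := Finite.one_lt_card (α := F)
    rw [hF, pow_zero] at this
    exact this.false
  intro z hz
  choose u _ hred hu using exists_teichmullerLift_eq hF hξ ι
  have hsum : ((∑ x, (z x : adjoinInt p ξ) * u x : adjoinInt p ξ) : ℂ_[p]) =
      ∑ x, (z x : ℂ_[p]) * teichmullerHom hF hξ ι x := by
    rw [AddSubmonoidClass.coe_finsetSum]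
    refine Finset.sum_congr rfl fun x _ => ?_
    rw [Subring.coe_mul, Subring.coe_intCast, hu]
    rfl
  rw [← hsum] at hz
  have h : reduction ι (∑ x, (z x : adjoinInt p ξ) * u x) = 0 := by
    rw [reduction, RingHom.comp_apply, mk_eq_zero_of_norm_lt_one hN hξ hz, map_zero]
  simpa only [map_sum, map_mul, map_intCast, hred] using h

end Teichmuller

/-! ### From norms to valuations -/

section Valuation

variable {p : ℕ} [Fact p.Prime]

theorem one_lt_prime_cast : (1 : ℝ) < p := by exact_mod_cast (Fact.out : p.Prime).one_lt

theorem nu_of_ne_zero {x : ℂ_[p]} (hx : x ≠ 0) : nu p x = ((-Real.logb p ‖x‖ : ℝ) : EReal) :=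
  if_neg hx

theorem nu_zero : nu p 0 = ⊤ := if_pos rfl

theorem nu_le_nu {x y : ℂ_[p]} (h : ‖x‖ ≤ ‖y‖) : nu p y ≤ nu p x := by
  by_cases hx : x = 0
  · rw [hx, nu_zero]
    exact le_top
  · have hy : y ≠ 0 := norm_pos_iff.1 ((norm_pos_iff.2 hx).trans_le h)
    rw [nu_of_ne_zero hx, nu_of_ne_zero hy, EReal.coe_le_coe_iff, neg_le_neg_iff]
    exact Real.logb_le_logb_of_le one_lt_prime_cast (norm_pos_iff.2 hx) h

theorem logb_norm_one_sub_root {ζ : ℂ_[p]} (hζ : IsPrimitiveRoot ζ p) :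
    Real.logb p ‖1 - ζ‖ = -(1 / ((p : ℝ) - 1)) := by
  have hp := one_lt_prime_cast (p := p)
  have h := congrArg (Real.logb p) (norm_one_sub_pow_pred hζ)
  rw [Real.logb_pow, norm_prime, Real.logb_inv, Real.logb_self_eq_one hp,
    Nat.cast_sub (Fact.out : p.Prime).one_le, Nat.cast_one] at h
  rw [← neg_div, eq_div_iff (by linarith), mul_comm, h]

/-- The valuation of `q⁻¹ * L * x`, where `q = p ^ e` and `L` has valuation `S / (p - 1)`. -/
theorem nu_div_mul {ζ : ℂ_[p]} (hζ : IsPrimitiveRoot ζ p) {L : ℂ_[p]} {S : ℕ}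
    (hL : ‖L‖ = ‖1 - ζ‖ ^ S) (e : ℕ) (x : ℂ_[p]) :
    nu p (((p ^ e : ℕ) : ℂ_[p])⁻¹ * (L * x)) =
      ((1 / ((p : ℝ) - 1) * (S : ℝ) : ℝ) : EReal) + nu p x - ((e : ℝ) : EReal) := by
  have hp := one_lt_prime_cast (p := p)
  have hζ1 : 0 < ‖1 - ζ‖ :=
    norm_pos_iff.2 (sub_ne_zero.2 (hζ.ne_one (Fact.out : p.Prime).one_lt).symm)
  by_cases hx : x = 0
  · rw [hx, mul_zero, mul_zero, nu_zero, EReal.coe_add_top, EReal.top_sub_coe]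
  have hL0 : L ≠ 0 := norm_pos_iff.1 (by rw [hL]; positivity)
  have hq0 : ((p ^ e : ℕ) : ℂ_[p]) ≠ 0 :=
    Nat.cast_ne_zero.2 (pow_ne_zero _ (Fact.out : p.Prime).ne_zero)
  rw [nu_of_ne_zero hx, nu_of_ne_zero (mul_ne_zero (inv_ne_zero hq0) (mul_ne_zero hL0 hx)),
    ← EReal.coe_add, ← EReal.coe_sub, EReal.coe_eq_coe_iff, norm_mul, norm_mul, norm_inv,
    Nat.cast_pow, norm_pow, norm_prime, hL, inv_pow, inv_inv,
    Real.logb_mul (by positivity) (mul_pos (by positivity) (norm_pos_iff.2 hx)).ne',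
    Real.logb_mul (by positivity) (norm_pos_iff.2 hx).ne', Real.logb_pow, Real.logb_pow,
    logb_norm_one_sub_root hζ, Real.logb_self_eq_one hp]
  ring

theorem norm_natCast (a : ℕ) : ‖(a : ℂ_[p])‖ = ‖(a : ℤ_[p])‖ := by
  rw [← norm_ofPadicInt, map_natCast]

theorem pow_dvd_iff_norm_le (t a : ℕ) : p ^ t ∣ a ↔ ‖(a : ℂ_[p])‖ ≤ (p : ℝ) ^ (-t : ℤ) := by
  have h := PadicInt.norm_int_le_pow_iff_dvd (p := p) (k := (a : ℤ)) (n := t)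
  rw [Int.cast_natCast] at h
  rw [norm_natCast, h]
  exact_mod_cast Iff.rfl

open Classical in
/-- The valuation of a code is attained at a codeword whose weight has maximal `p`-adic norm. -/
theorem codeValuation_eq_nu {K : Type*} [Field K] {n : ℕ} {D : Submodule K (Fin n → K)}
    {c₀ : Fin n → K} (hc₀ : c₀ ∈ D)
    (hmax : ∀ c ∈ D, ‖(hammingNorm c : ℂ_[p])‖ ≤ ‖(hammingNorm c₀ : ℂ_[p])‖) :
    codeValuation p D = nu p (hammingNorm c₀ : ℂ_[p]) := by
  have hp := one_lt_prime_cast (p := p)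
  have hdiv : ∀ t, IsDivisibleCode D (p ^ t) ↔ p ^ t ∣ hammingNorm c₀ := fun t => by
    refine ⟨fun h => by convert h c₀ hc₀, fun h c hc => ?_⟩
    have : p ^ t ∣ hammingNorm c :=
      (pow_dvd_iff_norm_le _ _).2 ((hmax c hc).trans ((pow_dvd_iff_norm_le _ _).1 h))
    convert this
  simp only [codeValuation, hdiv]
  -- Here every power of $p$ divides the weight, and both sides are infinite.
  by_cases h0 : hammingNorm c₀ = 0
  · rw [h0, Nat.cast_zero, nu_zero]
    refine (EReal.eq_top_iff_forall_lt _).2 fun y => ?_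
    obtain ⟨t, ht⟩ := exists_nat_gt y
    exact (EReal.coe_lt_coe_iff.2 ht).trans_le (le_iSup₂_of_le t (dvd_zero _) le_rfl)
  · have hn : (hammingNorm c₀ : ℂ_[p]) ≠ 0 := Nat.cast_ne_zero.2 h0
    obtain ⟨t, ht⟩ : ∃ t : ℕ, ‖(hammingNorm c₀ : ℂ_[p])‖ = (p : ℝ) ^ (-t : ℤ) := by
      rw [norm_natCast]
      exact ⟨_, PadicInt.norm_eq_zpow_neg_valuation (Nat.cast_ne_zero.2 h0)⟩
    have hnu : nu p (hammingNorm c₀ : ℂ_[p]) = ((t : ℝ) : EReal) := by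
      rw [nu_of_ne_zero hn, ht, ← Real.rpow_intCast, Real.logb_rpow (by linarith) hp.ne']
      simp
    rw [hnu]
    refine le_antisymm (iSup₂_le fun s hs => ?_)
      (le_iSup₂_of_le t ((pow_dvd_iff_norm_le _ _).2 ht.le) le_rfl)
    rw [pow_dvd_iff_norm_le, ht, zpow_le_zpow_iff_right₀ hp] at hs
    exact EReal.coe_le_coe_iff.2 (by exact_mod_cast (by omega : s ≤ t))

end Valuation

/-! ### Trace codewords by messages, and the theorem -/

theorem mem_traceCode_iff {K F : Type*} [Field K] [Field F] [Algebra K F] {n k : ℕ}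
    {C : Submodule F (Fin n → F)} {G : Matrix (Fin k) (Fin n) F} (hG : IsGeneratorMatrix G C)
    {c : Fin n → K} :
    c ∈ traceCode K C ↔
      ∃ a : Fin k → F, (fun j => Algebra.trace K F (∑ i, a i * G i j)) = c := by
  rw [traceCode, Submodule.mem_map, ← hG]
  constructor
  · rintro ⟨x, hx, rfl⟩
    obtain ⟨a, rfl⟩ := (Submodule.mem_span_range_iff_exists_fun F).1
      (Submodule.restrictScalars_mem K _ _ |>.1 hx)
    refine ⟨a, funext fun j => ?_⟩
    simp [LinearMap.compLeft_apply, Finset.sum_apply]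
  · rintro ⟨a, rfl⟩
    refine ⟨∑ i, a i • G.row i, (Submodule.restrictScalars_mem K _ _).2
      ((Submodule.mem_span_range_iff_exists_fun F).2 ⟨a, rfl⟩), funext fun j => ?_⟩
    simp [LinearMap.compLeft_apply, Finset.sum_apply]

end TraceCode

theorem mainTheorem1 (p e q m : ℕ) [Fact p.Prime] (hq : q = p ^ e)
    (K F : Type*) [Field K] [Field F] [Finite K] [Finite F] [Algebra K F]
    (hK : Nat.card K = q) (hm : Module.finrank K F = m)
    (ξ : ℂ_[p]) (hξ : IsPrimitiveRoot ξ (q ^ m - 1)) (ι : TraceCode.ResidueRing p ξ ≃+* F)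
    (n k : ℕ) (hk : 0 < k) (C : Submodule F (Fin n → F)) (G : Matrix (Fin k) (Fin n) F)
    (hG : TraceCode.IsGeneratorMatrix G C) :
    IsLeast
      {v : EReal | ∃ r : Fin k → ℕ, (∀ i, r i ≤ q ^ m - 1) ∧ (q - 1) ∣ ∑ i, r i ∧ 0 < ∑ i, r i ∧
        v = ((1 / ((p : ℝ) - 1) * ∑ i, (TraceCode.digitSum p (r i) : ℝ) : ℝ) : EReal)
          + TraceCode.nu p (∑ j, ∏ i, TraceCode.teichmullerLift ι (G i j) ^ r i)
          - ((e : ℝ) : EReal)}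
      (TraceCode.codeValuation p (TraceCode.traceCode K C)) := by
  classical
  open TraceCode in
  have := Fintype.ofFinite K
  have := Fintype.ofFinite F
  have hcardK : Fintype.card K = q := by rw [← Nat.card_eq_fintype_card, hK]
  have hcardF : Fintype.card F = q ^ m := by
    rw [Module.card_eq_pow_finrank (K := K), hcardK, hm]
  have hF : Nat.card F = p ^ (e * m) := by rw [Nat.card_eq_fintype_card, hcardF, hq, pow_mul]
  have hξ' : IsPrimitiveRoot ξ (p ^ (e * m) - 1) := by rwa [pow_mul, ← hq]
  have : CharP K p := charP_of_card_eq_prime_pow (hcardK.trans hq)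
  have : CharP F p := charP_of_injective_algebraMap (algebraMap K F).injective p
  let _ : Algebra (ZMod p) K := ZMod.algebra K p
  let _ : Algebra (ZMod p) F := ZMod.algebra F p
  have : IsScalarTower (ZMod p) K F := IsScalarTower.of_algebraMap_eq' (Subsingleton.elim _ _)
  obtain ⟨ζ, hζ⟩ : ∃ ζ : ℂ_[p], IsPrimitiveRoot ζ p :=
    HasEnoughRootsOfUnity.exists_primitiveRoot ℂ_[p] p
  set T := teichmullerHom hF hξ' ι
  have hT : IsMultiplicativeLift T := isMultiplicativeLift_teichmullerHom hF hξ' ι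
  have hcardF1 := Fintype.one_lt_card (α := F)
  have hq0 : 0 < ‖(q : ℂ_[p])‖ := by
    rw [norm_pos_iff, Nat.cast_ne_zero, ← hcardK]
    exact Fintype.card_ne_zero
  let w : (Fin k → F) → ℂ_[p] := fun a =>
    (hammingNorm fun j => Algebra.trace K F (∑ i, a i * G i j) : ℂ_[p])
  let c : (Fin k → Fin (Fintype.card F)) → ℂ_[p] := fun r => weightCoeff hζ K T G fun i => r i
  have hw : ∀ a, ‖∑ r, c r * ∏ i, T (a i) ^ (r i : ℕ)‖ = ‖(q : ℂ_[p])‖ * ‖w a‖ := by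
    intro a
    rw [← hcardK]
    exact norm_sum_weightCoeff hζ hT G a
  obtain ⟨a₀, ha₀⟩ := Finite.exists_max fun a => ‖w a‖
  have hval : codeValuation p (traceCode K C) = nu p (w a₀) := by
    refine codeValuation_eq_nu ((mem_traceCode_iff hG).2 ⟨a₀, rfl⟩) fun x hx => ?_
    obtain ⟨a, rfl⟩ := (mem_traceCode_iff hG).1 hx
    exact ha₀ a
  have hterm : ∀ r : Fin k → Fin (Fintype.card F), q - 1 ∣ ∑ i, (r i : ℕ) →
      0 < ∑ i, (r i : ℕ) → nu p ((q : ℂ_[p])⁻¹ * c r) =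
        ((1 / ((p : ℝ) - 1) * ∑ i, (digitSum p (r i) : ℝ) : ℝ) : EReal)
          + nu p (∑ j, ∏ i, teichmullerLift ι (G i j) ^ (r i : ℕ)) - ((e : ℝ) : EReal) := by
    intro r hdvd hpos
    have hc : c r = (∏ i, charCoeff hζ T (r i)) *
        ∑ j, ∏ i, teichmullerLift ι (G i j) ^ (r i : ℕ) := if_pos ⟨hpos, by rwa [hcardK]⟩
    rw [hc, hq, nu_div_mul hζ (norm_prod_charCoeff hζ hT _ fun i => (r i).2), Nat.cast_sum]
  have hle : ∀ r, ‖(q : ℂ_[p])⁻¹ * c r‖ ≤ ‖w a₀‖ := by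
    intro r
    rw [norm_mul, norm_inv, inv_mul_le_iff₀ hq0]
    refine norm_coeff_le hT c (fun a => ?_) r
    rw [hw]
    exact mul_le_mul_of_nonneg_left (ha₀ a) hq0.le
  constructor
  · let s : Finset (Fin k → Fin (Fintype.card F)) :=
      {r | q - 1 ∣ ∑ i, (r i : ℕ) ∧ 0 < ∑ i, (r i : ℕ)}
    have hs : s.Nonempty := by
      -- All exponents equal to $q^m-1$: admissible since $q-1\mid q^m-1$ and $k>0$.
      refine ⟨fun _ => ⟨Fintype.card F - 1, by omega⟩, ?_⟩
      simp only [s, Finset.mem_filter, Finset.mem_univ, true_and, Finset.sum_const,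
        Finset.card_univ, Fintype.card_fin, smul_eq_mul]
      refine ⟨Dvd.dvd.mul_left ?_ _, Nat.mul_pos hk (by omega)⟩
      rw [hcardF]
      simpa using Nat.sub_dvd_pow_sub_pow q 1 m
    obtain ⟨r, hr, hmax⟩ := s.exists_max_image (fun r => ‖c r‖) hs
    obtain ⟨hdvd, hpos⟩ := (Finset.mem_filter.1 hr).2
    refine ⟨fun i => r i, fun i => ?_, hdvd, hpos, ?_⟩
    · change (r i : ℕ) ≤ q ^ m - 1
      omega
    rw [hval, ← hterm r hdvd hpos]
    -- The largest coefficient bounds all values, in particular that at `a₀`; coefficients outside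
    -- `s` are zero.
    refine le_antisymm (nu_le_nu (hle r)) (nu_le_nu ?_)
    rw [norm_mul, norm_inv, ← div_eq_inv_mul, le_div_iff₀ hq0, mul_comm, ← hw]
    refine norm_eval_le T c (fun r' => ?_) (norm_nonneg _) a₀
    by_cases hr' : r' ∈ s
    · exact hmax r' hr'
    · have : c r' = 0 := if_neg fun h => hr' (Finset.mem_filter.2
        ⟨Finset.mem_univ _, by rw [← hcardK]; exact h.2, h.1⟩)
      rw [this, norm_zero]
      exact norm_nonneg _
  · rintro _ ⟨r, hr, hdvd, hpos, rfl⟩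
    let r' : Fin k → Fin (Fintype.card F) := fun i => ⟨r i, by have := hr i; omega⟩
    rw [hval, ← hterm r' hdvd hpos]
    exact nu_le_nu (hle r')
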